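/- Let $\alpha,\beta>0$, $n\ge 0$ an integer, $u_0\in L^2(\mathbb R^n)$, and let $u\in C([0,\infty);L^2(\mathbb R^n))$ be the solution of the free Schrödinger equation $$\partial_t u=i\Delta u\quad (t>0,\ x\in\mathbb R^n),\qquad u(\cdot,0)=u_0,$$ the equation being understood in the sense of tempered distributions. Write $\widehat f(\xi)=(2\pi)^{-n/2}\int_{\mathbb R^n}e^{-ix\cdot\xi}f(x)\,dx$ for the (unitary) Fourier transform on $L^2(\mathbb R^n)$, $\|\cdot\|_2$ for the $L^2(\mathbb R^n)$ norm (equal to $+\infty$ if the function is not square integrable), and, for $T>0$ and $t\ge 0$, $$\theta(t)=\frac{\beta(T-t)}{T(\alpha t+\beta)},\qquad \mu(t)=\frac{\beta}{\alpha t+\beta}.$$ Then for every $\lambda\in\mathbb R^n$ and $T>0$ each of the following estimates holds; in particular its left-hand side is finite whenever its right-hand side is (in $[0,\infty]$ with $\infty^0=1$ and $0\cdot\infty=0$): $$\|e^{\frac{\lambda\cdot x}{\alpha t+\beta}}u(t)\|_2\le \|e^{\frac{\lambda\cdot x}{\beta}}u_0\|_2^{\theta(t)}\,\|e^{\frac{\lambda\cdot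 x}{\alpha T+\beta}}u(T)\|_2^{1-\theta(t)},\qquad 0\le t\le T,$$ $$\|e^{\frac{\lambda\cdot x}{\alpha t+\beta}}u(t)\|_2\le \|e^{\frac{\lambda\cdot x}{\beta}}u_0\|_2^{\mu(t)}\,\|e^{\frac{2\lambda\cdot \xi}{\alpha}}\widehat{u_0}\|_2^{1-\mu(t)},\qquad t\ge 0,$$ $$\|e^{\frac{|x|^2}{(\alpha t+\beta)^2}}u(t)\|_2\le \|e^{\frac{|x|^2}{\beta^2}}u_0\|_2^{\theta(t)}\,\|e^{\frac{|x|^2}{(\alpha T+\beta)^2}}u(T)\|_2^{1-\theta(t)},\qquad 0\le t\le T,$$ $$\|e^{\frac{|x|^2}{(\alpha t+\beta)^2}}u(t)\|_2\le \|e^{\frac{|x|^2}{\beta^2}}u_0\|_2^{\mu(t)}\,\|e^{\frac{4|\xi|^2}{\alpha^2}}\widehat{u_0}\|_2^{1-\mu(t)},\qquad t\ge 0.$$ -/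

import Mathlib

open MeasureTheory Set
open scoped ENNReal SchwartzMap FourierTransform Laplacian

noncomputable section

/-- Complex-valued `L²` functions on `ℝⁿ` with Lebesgue measure. -/
abbrev L2Space (n : ℕ) : Type :=
  Lp ℂ 2 (volume : Measure (EuclideanSpace ℝ (Fin n)))

/-- `u` is the solution of `∂ₜ u = i Δ u` for `t > 0`, `u(0) = u₀`, with `u` a continuous curve in
`L²(ℝⁿ)` on `[0, ∞)`. The equation is understood in the sense of tempered distributions:
`d/dt ⟨u(t), φ⟩ = ⟨i Δ u(t), φ⟩` for every Schwartz function `φ` and every `t > 0`. -/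
structure IsFreeSchrodingerSolution {n : ℕ} (u₀ : L2Space n) (u : ℝ → L2Space n) : Prop where
  continuousOn : ContinuousOn u (Ici 0)
  initial : u 0 = u₀
  equation : ∀ t : ℝ, 0 < t → ∀ φ : 𝓢(EuclideanSpace ℝ (Fin n), ℂ),
    HasDerivAt (fun s : ℝ => (u s : 𝓢'(EuclideanSpace ℝ (Fin n), ℂ)) φ)
      ((Complex.I • Δ (u t : 𝓢'(EuclideanSpace ℝ (Fin n), ℂ))) φ) t

/-- The unitary Fourier transform on `L²(ℝⁿ)` with angular frequency, that is, the extension to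
`L²` of `f ↦ (2π)^(-n/2) ∫ exp(-i x·ξ) f(x) dx`. Mathlib's `𝓕` is the extension of
`f ↦ ∫ exp(-2πi x·ξ) f(x) dx`. -/
def angularFourier {n : ℕ} (f : L2Space n) (ξ : EuclideanSpace ℝ (Fin n)) : ℂ :=
  (((2 * Real.pi) ^ (-(n : ℝ) / 2) : ℝ) : ℂ) *
    (𝓕 f : L2Space n) ((2 * Real.pi)⁻¹ • ξ)

/-- The weighted norm `‖e^w f‖₂`, with value `∞` when `e^w f` is not square integrable. -/
def expWeightedNorm {n : ℕ} (w : EuclideanSpace ℝ (Fin n) → ℝ)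
    (f : EuclideanSpace ℝ (Fin n) → ℂ) : ℝ≥0∞ :=
  eLpNorm (fun x => (Real.exp (w x) : ℂ) * f x) 2 volume

/-- `θ(t) = β (T - t) / (T (α t + β))`. -/
def thetaExponent (α β T t : ℝ) : ℝ := β * (T - t) / (T * (α * t + β))

/-- `μ(t) = β / (α t + β)`. -/
def muExponent (α β t : ℝ) : ℝ := β / (α * t + β)

end

/-!
On the Fourier side the solution at time `t` is `exp (-4π² i t |ξ|²) û₀`. Conjugation by this
multiplier maps the position `x` to `x + 2tp`, where `p = -i∇`, so `‖exp (a·x) u(t)‖` is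
formally the norm of the Weyl operator `exp (a·x + 2t a·p)` applied to `u₀`, and an exponential
weight on `û₀` is a Weyl operator `exp (c·p)`. Both sides of the linear estimates are thus norms
`‖exp (a·x + c·p) u₀‖`, and in the `(a, c)` plane the left-hand side lies on the segment between
the two factors on the right. Along that segment the pairing of the Weyl operator with a
combination of Gaussians is entire, imaginary steps are unitary up to a scalar, and the three lines
theorem interpolates.

The quadratic weights follow by integrating the squares of the linear estimates against a Gaussian
in `λ` and applying Hölder's inequality.
-/

noncomputable section

variable {n : ℕ}

local notation "ℝⁿ" => EuclideanSpace ℝ (Fin n)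

/-! ### The Fourier transform on `L¹` and `L²` -/

section Fourier

variable {V : Type*} [NormedAddCommGroup V] [InnerProductSpace ℝ V] [FiniteDimensional ℝ V]
  [MeasurableSpace V] [BorelSpace V]

/-- The bilinear pairing `⟨f, g⟩ = ∫ f g` on `L²`, without complex conjugation, so that the Fourier
transform is symmetric for it. -/
def l2Pairing : Lp ℂ 2 (volume : Measure V) →L[ℂ] Lp ℂ 2 (volume : Measure V) →L[ℂ] ℂ :=
  (ContinuousLinearMap.mul ℂ ℂ).lpPairing volume 2 2

lemma l2Pairing_eq_integral (f g : Lp ℂ 2 (volume : Measure V)) :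
    l2Pairing f g = ∫ x, f x * g x :=
  ContinuousLinearMap.lpPairing_eq_integral _ f g

lemma l2Pairing_toLp (f : Lp ℂ 2 (volume : Measure V)) {g : V → ℂ} (hg : MemLp g 2 volume) :
    l2Pairing f (hg.toLp g) = ∫ x, f x * g x := by
  rw [l2Pairing_eq_integral]
  refine integral_congr_ae ?_
  filter_upwards [hg.coeFn_toLp] with x hx
  rw [hx]

lemma l2Pairing_schwartz (f : Lp ℂ 2 (volume : Measure V)) (φ : 𝓢(V, ℂ)) :
    l2Pairing f (φ.toLp 2) = (f : 𝓢'(V, ℂ)) φ := by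
  rw [Lp.toTemperedDistribution_apply]
  refine (l2Pairing_toLp f (φ.memLp 2)).trans ?_
  simp only [smul_eq_mul, mul_comm]

lemma norm_integral_mul_le {α : Type*} [MeasurableSpace α] {μ : Measure α} {f g : α → ℂ}
    (hf : MemLp f 2 μ) (hg : MemLp g 2 μ) :
    ‖∫ x, f x * g x ∂μ‖ ≤ (eLpNorm f 2 μ).toReal * (eLpNorm g 2 μ).toReal := by
  rw [← ENNReal.toReal_mul, ← toReal_enorm]
  refine ENNReal.toReal_mono (ENNReal.mul_ne_top hf.2.ne hg.2.ne) ?_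
  calc ‖∫ x, f x * g x ∂μ‖ₑ ≤ ∫⁻ x, ‖f x * g x‖ₑ ∂μ := enorm_integral_le_lintegral_enorm _
    _ = eLpNorm (f • g) 1 μ := eLpNorm_one_eq_lintegral_enorm.symm
    _ ≤ eLpNorm f 2 μ * eLpNorm g 2 μ := eLpNorm_smul_le_mul_eLpNorm hg.1 hf.1

lemma l2Pairing_fourier (f g : Lp ℂ 2 (volume : Measure V)) :
    l2Pairing (𝓕 f) g = l2Pairing f (𝓕 g) := by
  have hF : Continuous fun g : Lp ℂ 2 (volume : Measure V) ↦ (𝓕 g : Lp ℂ 2 (volume : Measure V)) :=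
    (Lp.fourierTransformₗᵢ V ℂ).continuous
  refine DenseRange.induction_on (p := fun g ↦ l2Pairing (𝓕 f) g = l2Pairing f (𝓕 g))
    (SchwartzMap.denseRange_toLpCLM (p := 2) ENNReal.ofNat_ne_top) g ?_ fun φ ↦ ?_
  · exact isClosed_eq (l2Pairing (𝓕 f)).continuous ((l2Pairing f).continuous.comp hF)
  · rw [SchwartzMap.toLpCLM_apply, SchwartzMap.toLp_fourier_eq, l2Pairing_schwartz,
      l2Pairing_schwartz, ← Lp.fourier_toTemperedDistribution_eq,
      TemperedDistribution.fourier_apply]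

lemma integral_lp_fourier_mul_schwartz (f : Lp ℂ 2 (volume : Measure V)) (φ : 𝓢(V, ℂ)) :
    ∫ x, (𝓕 f : Lp ℂ 2 (volume : Measure V)) x * φ x = ∫ x, f x * 𝓕 φ x := by
  have h := l2Pairing_fourier f (φ.toLp 2)
  rw [SchwartzMap.toLp_fourier_eq] at h
  exact (l2Pairing_toLp _ (φ.memLp 2)).symm.trans (h.trans (l2Pairing_toLp _ ((𝓕 φ).memLp 2)))

lemma integral_fourier_mul_schwartz {g : V → ℂ} (hg : Integrable g) (φ : 𝓢(V, ℂ)) :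
    ∫ x, 𝓕 g x * φ x = ∫ x, g x * 𝓕 φ x := by
  simpa using! VectorFourier.integral_fourierIntegral_smul_eq_flip (L := innerₗ V)
    Real.continuous_fourierChar continuous_inner hg φ.integrable

lemma ae_eq_of_integral_mul_schwartz_eq {f g : V → ℂ} (hf : LocallyIntegrable f)
    (hg : LocallyIntegrable g) (h : ∀ φ : 𝓢(V, ℂ), ∫ x, f x * φ x = ∫ x, g x * φ x) :
    f =ᵐ[volume] g := by
  refine ae_eq_of_integral_contDiff_smul_eq hf hg fun φ hφ hφc ↦ ?_
  have hc : HasCompactSupport (Complex.ofRealCLM ∘ φ) := hφc.comp_left rfl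
  simpa [mul_comm] using h (hc.toSchwartzMap (Complex.ofRealCLM.contDiff.comp hφ))

lemma fourier_add_of_integrable {f g : V → ℂ} (hf : Integrable f) (hg : Integrable g) :
    𝓕 (f + g) = 𝓕 f + 𝓕 g :=
  VectorFourier.fourierIntegral_add Real.continuous_fourierChar continuous_inner hf hg

lemma fourier_const_smul (r : ℂ) (f : V → ℂ) : 𝓕 (r • f) = r • 𝓕 f :=
  VectorFourier.fourierIntegral_const_smul _ _ _ f r

lemma fourier_toLp_ae_eq {g : V → ℂ} (h1 : Integrable g) (h2 : MemLp g 2 volume) :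
    (𝓕 (h2.toLp g) : Lp ℂ 2 (volume : Measure V)) =ᵐ[volume] 𝓕 g := by
  have hc : Continuous (𝓕 g) :=
    VectorFourier.fourierIntegral_continuous Real.continuous_fourierChar continuous_inner h1
  refine ae_eq_of_integral_mul_schwartz_eq ((Lp.memLp _).locallyIntegrable one_le_two)
    hc.locallyIntegrable fun φ ↦ ?_
  calc ∫ x, (𝓕 (h2.toLp g) : Lp ℂ 2 (volume : Measure V)) x * φ x
      = ∫ x, h2.toLp g x * 𝓕 φ x := integral_lp_fourier_mul_schwartz _ φ
    _ = ∫ x, g x * 𝓕 φ x := by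
        refine integral_congr_ae ?_
        filter_upwards [h2.coeFn_toLp] with x hx
        rw [hx]
    _ = ∫ x, 𝓕 g x * φ x := (integral_fourier_mul_schwartz h1 φ).symm

lemma memLp_fourier {g : V → ℂ} (h1 : Integrable g) (h2 : MemLp g 2 volume) :
    MemLp (𝓕 g) 2 volume :=
  (memLp_congr_ae (fourier_toLp_ae_eq h1 h2)).1 (Lp.memLp _)

lemma eLpNorm_fourier {g : V → ℂ} (h1 : Integrable g) (h2 : MemLp g 2 volume) :
    eLpNorm (𝓕 g) 2 volume = eLpNorm g 2 volume := by
  have h := Lp.norm_fourier_eq (h2.toLp g)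
  rw [Lp.norm_def, eLpNorm_congr_ae (fourier_toLp_ae_eq h1 h2), Lp.norm_toLp] at h
  exact (ENNReal.toReal_eq_toReal_iff' (memLp_fourier h1 h2).2.ne h2.2.ne).1 h

lemma integral_fourier_mul (f : Lp ℂ 2 (volume : Measure V)) {g : V → ℂ} (h1 : Integrable g)
    (h2 : MemLp g 2 volume) :
    ∫ x, (𝓕 f : Lp ℂ 2 (volume : Measure V)) x * g x = ∫ x, f x * 𝓕 g x := by
  rw [← l2Pairing_toLp _ h2, l2Pairing_fourier, l2Pairing_eq_integral]
  refine integral_congr_ae ?_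
  filter_upwards [fourier_toLp_ae_eq h1 h2] with x hx
  rw [hx]

lemma ae_eq_zero_of_fourier_eq_zero {g : V → ℂ} (hg : Integrable g) (h : ∀ x, 𝓕 g x = 0) :
    g =ᵐ[volume] 0 := by
  refine ae_eq_of_integral_mul_schwartz_eq hg.locallyIntegrable
    locallyIntegrable_zero fun φ ↦ ?_
  have key := integral_fourier_mul_schwartz hg (𝓕⁻ φ)
  rw [FourierTransform.fourier_fourierInv_eq] at key
  simp [← key, h]

end Fourier

/-! ### The free evolution on the Fourier side -/

section Propagation

open Filter Topology Asymptotics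
open scoped ContDiff

variable {V : Type*} [NormedAddCommGroup V] [InnerProductSpace ℝ V] [FiniteDimensional ℝ V]
  [MeasurableSpace V] [BorelSpace V]

lemma memLp_mul_of_hasCompactSupport {g φ : V → ℂ} (hg : Continuous g) (hφ : Continuous φ)
    (hc : HasCompactSupport φ) : MemLp (fun x ↦ g x * φ x) 2 volume :=
  (hg.mul hφ).memLp_of_hasCompactSupport hc.mul_left

lemma hasDerivAt_toLp_of_norm_sub_le {α : Type*} [MeasurableSpace α] {μ : Measure α}
    {f : ℝ → α → ℂ} {f' B : α → ℂ} {s : ℝ} (hf : ∀ r, MemLp (f r) 2 μ) (hf' : MemLp f' 2 μ)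
    (hB : MemLp B 2 μ)
    (h : ∀ᶠ r : ℝ in 𝓝 0, ∀ x, ‖f (s + r) x - f s x - r * f' x‖ ≤ r ^ 2 * ‖B x‖) :
    HasDerivAt (fun r ↦ (hf r).toLp) hf'.toLp s := by
  refine hasDerivAt_iff_isLittleO_nhds_zero.2 ((IsBigO.of_bound ‖hB.toLp‖ ?_).trans_isLittleO
    (isLittleO_pow_id one_lt_two))
  filter_upwards [h] with r hr
  rw [Real.norm_of_nonneg (sq_nonneg r), mul_comm]
  refine Lp.norm_le_mul_norm_of_ae_le_mul ?_
  filter_upwards [Lp.coeFn_sub ((hf (s + r)).toLp - (hf s).toLp) (r • hf'.toLp),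
    Lp.coeFn_sub (hf (s + r)).toLp (hf s).toLp, Lp.coeFn_smul r hf'.toLp,
    (hf (s + r)).coeFn_toLp, (hf s).coeFn_toLp, hf'.coeFn_toLp, hB.coeFn_toLp]
    with x h₁ h₂ h₃ h₄ h₅ h₆ h₇
  simpa only [h₁, h₂, h₃, h₄, h₅, h₆, h₇, Pi.sub_apply, Pi.smul_apply, Complex.real_smul]
    using hr x

lemma hasDerivAt_toLp_cexp_mul {m φ : V → ℂ} (hm : Continuous m) (hφ : Continuous φ)
    (hc : HasCompactSupport φ) (s : ℝ) :
    HasDerivAt (fun r : ℝ ↦ (memLp_mul_of_hasCompactSupport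
        (g := fun x ↦ Complex.exp (r * m x)) (by fun_prop) hφ hc).toLp)
      ((memLp_mul_of_hasCompactSupport
        (g := fun x ↦ m x * Complex.exp (s * m x)) (by fun_prop) hφ hc).toLp) s := by
  obtain ⟨C, hC⟩ := hc.isCompact.exists_bound_of_continuousOn hm.continuousOn
  have hsmall : ∀ᶠ r : ℝ in 𝓝 0, |r| * |C| ≤ 1 := by
    have : Continuous fun r : ℝ ↦ |r| * |C| := by fun_prop
    exact (this.tendsto' 0 0 (by simp)).eventually (eventually_le_nhds one_pos)
  refine hasDerivAt_toLp_of_norm_sub_le _ _ (memLp_mul_of_hasCompactSupport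
    (g := fun x ↦ C ^ 2 * Complex.exp (s * m x)) (by fun_prop) hφ hc) ?_
  filter_upwards [hsmall] with r hr x
  rcases eq_or_ne (φ x) 0 with hx | hx
  · simp [hx]
  have hz : ‖(r : ℂ) * m x‖ ≤ |r| * |C| := by
    rw [norm_mul, Complex.norm_real, Real.norm_eq_abs]
    gcongr
    exact (hC x (subset_tsupport φ hx)).trans (le_abs_self C)
  calc ‖Complex.exp ((s + r : ℝ) * m x) * φ x - Complex.exp (s * m x) * φ x -
        r * (m x * Complex.exp (s * m x) * φ x)‖
      = ‖Complex.exp (r * m x) - 1 - r * m x‖ * ‖Complex.exp (s * m x) * φ x‖ := by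
        rw [← norm_mul, Complex.ofReal_add, add_mul, Complex.exp_add]
        ring_nf
    _ ≤ (|r| * |C|) ^ 2 * ‖Complex.exp (s * m x) * φ x‖ := by
        gcongr
        exact (Complex.norm_exp_sub_one_sub_id_le (hz.trans hr)).trans (by gcongr)
    _ = r ^ 2 * ‖C ^ 2 * Complex.exp (s * m x) * φ x‖ := by
        simp only [norm_mul, norm_pow, Complex.norm_real, Real.norm_eq_abs, sq_abs, mul_pow]
        ring

/-- A product rule in which one factor is only weakly differentiable. -/
lemma hasDerivAt_l2Pairing {v p : ℝ → Lp ℂ 2 (volume : Measure V)}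
    {p' : Lp ℂ 2 (volume : Measure V)} {d : ℂ} {s : ℝ}
    (hv : ContinuousAt v s) (hp : HasDerivAt p p' s)
    (hd : HasDerivAt (fun r ↦ l2Pairing (v r) (p s)) d s) :
    HasDerivAt (fun r ↦ l2Pairing (v r) (p r)) (d + l2Pairing (v s) p') s := by
  have hvp : HasDerivAt (fun r ↦ l2Pairing (v r) (p r - p s)) (l2Pairing (v s) p') s := by
    rw [hasDerivAt_iff_tendsto_slope] at hp ⊢
    have hv' : Tendsto v (𝓝[≠] s) (𝓝 (v s)) := hv.tendsto.mono_left nhdsWithin_le_nhds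
    refine ((l2Pairing.continuous₂.tendsto (v s, p')).comp (hv'.prodMk_nhds hp)).congr fun r ↦ ?_
    simp only [Function.comp, slope, vsub_eq_sub, sub_self, map_zero, sub_zero]
    exact ContinuousLinearMap.map_smul_of_tower _ _ _
  refine (hd.add hvp).congr_of_eventuallyEq (Eventually.of_forall fun r ↦ ?_)
  simp only [Pi.add_apply, map_sub]
  ring

variable {u₀ : L2Space n} {u : ℝ → L2Space n}

/-- The symbol `-4π² i |ξ|²` of `i Δ`. -/
def freeSymbol (ξ : ℝⁿ) : ℂ := -(4 * Real.pi ^ 2 * Complex.I * (‖ξ‖ : ℂ) ^ 2)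

lemma contDiff_freeSymbol : ContDiff ℝ ∞ (freeSymbol : ℝⁿ → ℂ) := by
  have : ContDiff ℝ ∞ fun ξ : ℝⁿ ↦ ((‖ξ‖ ^ 2 : ℝ) : ℂ) :=
    Complex.ofRealCLM.contDiff.comp (contDiff_norm_sq ℝ)
  simp only [Complex.ofReal_pow] at this
  exact (contDiff_const.mul this).neg

@[fun_prop]
lemma continuous_freeSymbol : Continuous (freeSymbol : ℝⁿ → ℂ) := contDiff_freeSymbol.continuous

lemma norm_exp_mul_freeSymbol (t : ℝ) (ξ : ℝⁿ) : ‖Complex.exp (t * freeSymbol ξ)‖ = 1 := by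
  rw [← Complex.norm_exp_ofReal_mul_I (-(t * (4 * Real.pi ^ 2 * ‖ξ‖ ^ 2))), freeSymbol]
  congr 2
  push_cast
  ring

namespace IsFreeSchrodingerSolution

lemma hasDerivAt_l2Pairing_fourier (hu : IsFreeSchrodingerSolution u₀ u) {t : ℝ} (ht : 0 < t)
    (ψ χ : 𝓢(ℝⁿ, ℂ)) (hχ : ∀ ξ, χ ξ = freeSymbol ξ * ψ ξ) :
    HasDerivAt (fun s ↦ l2Pairing (𝓕 (u s)) (ψ.toLp 2)) (l2Pairing (𝓕 (u t)) (χ.toLp 2)) t := by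
  have hpair (s : ℝ) : l2Pairing (𝓕 (u s)) (ψ.toLp 2) = (u s : 𝓢'(ℝⁿ, ℂ)) (𝓕 ψ) := by
    rw [l2Pairing_schwartz, ← Lp.fourier_toTemperedDistribution_eq,
      TemperedDistribution.fourier_apply]
  have hgrowth : (fun x : ℝⁿ ↦ Complex.ofReal (‖x‖ ^ 2)).HasTemperateGrowth := by fun_prop
  have hχ' : χ = Complex.I • (-(2 * Real.pi) ^ 2 : ℝ) •
      SchwartzMap.smulLeftCLM ℂ (fun x : ℝⁿ ↦ Complex.ofReal (‖x‖ ^ 2)) ψ := by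
    ext ξ
    simp only [hχ, _root_.smul_apply, SchwartzMap.smulLeftCLM_apply_apply hgrowth, freeSymbol,
      smul_eq_mul, Complex.real_smul]
    push_cast
    ring
  simp only [hpair]
  convert hu.equation t ht (𝓕 ψ) using 1
  rw [TemperedDistribution.laplacian_eq_fourierMultiplierCLM, l2Pairing_schwartz, hχ']
  simp only [_root_.smul_apply, TemperedDistribution.fourierMultiplierCLM_apply_apply,
    FourierTransform.fourierInv_fourier_eq]
  rw [← Lp.fourier_toTemperedDistribution_eq, TemperedDistribution.fourier_apply,
    ← TemperedDistribution.fourier_apply, ← TemperedDistribution.fourier_apply, map_smul,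
    ← Complex.coe_smul, map_smul, Complex.coe_smul]

/-- Testing `û` against the backward evolution of a test function gives a conserved quantity. -/
lemma integral_fourier_mul_exp_eq (hu : IsFreeSchrodingerSolution u₀ u) {t : ℝ} (ht : 0 ≤ t)
    {φ : ℝⁿ → ℂ} (hφ : ContDiff ℝ ∞ φ) (hc : HasCompactSupport φ) :
    ∫ ξ, (𝓕 (u t) : L2Space n) ξ * φ ξ =
      ∫ ξ, (𝓕 u₀ : L2Space n) ξ * (Complex.exp (t * freeSymbol ξ) * φ ξ) := by
  have hexp (c : ℝ) : ContDiff ℝ ∞ fun ξ : ℝⁿ ↦ Complex.exp (c * freeSymbol ξ) :=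
    (contDiff_const.mul contDiff_freeSymbol).cexp
  have hv : ContinuousOn (fun s ↦ (𝓕 (u s) : L2Space n)) (Ici 0) :=
    (Lp.fourierTransformₗᵢ ℝⁿ ℂ).continuous.comp_continuousOn hu.continuousOn
  let p (s : ℝ) : L2Space n := (memLp_mul_of_hasCompactSupport
    (g := fun ξ ↦ Complex.exp (s * freeSymbol ξ)) (by fun_prop) hφ.continuous hc).toLp
  let N (s : ℝ) : ℂ := l2Pairing (𝓕 (u (t - s))) (p s)
  have hp (s : ℝ) : HasDerivAt p _ s := hasDerivAt_toLp_cexp_mul (by fun_prop) hφ.continuous hc s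
  have hvt : ContinuousOn (fun s ↦ (𝓕 (u (t - s)) : L2Space n)) (Icc 0 t) :=
    hv.comp (by fun_prop) fun s hs ↦ sub_nonneg.2 hs.2
  have hcont : ContinuousOn N (Icc 0 t) := (l2Pairing.continuous.comp_continuousOn hvt).clm_apply
    fun s _ ↦ (hp s).continuousAt.continuousWithinAt
  have hderiv : ∀ s ∈ Ico 0 t, HasDerivAt N 0 s := by
    intro s hs
    let ψ : 𝓢(ℝⁿ, ℂ) := HasCompactSupport.toSchwartzMap (hc.mul_left (f := fun ξ ↦ _))
      ((hexp s).mul hφ)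
    let χ : 𝓢(ℝⁿ, ℂ) := HasCompactSupport.toSchwartzMap (hc.mul_left (f := fun ξ ↦ _))
      ((contDiff_freeSymbol.mul (hexp s)).mul hφ)
    have h := (hu.hasDerivAt_l2Pairing_fourier (sub_pos.2 hs.2) ψ χ
      fun ξ ↦ mul_assoc _ _ _).comp_const_sub t s
    have hcts : ContinuousAt (fun r ↦ (𝓕 (u (t - r)) : L2Space n)) s :=
      (hv.continuousAt (Ici_mem_nhds (sub_pos.2 hs.2))).comp (f := fun r ↦ t - r) (by fun_prop)
    exact (hasDerivAt_l2Pairing hcts (hp s) h).congr_deriv (neg_add_cancel _)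
  have hconst : N t = N 0 := constant_of_has_deriv_right_zero hcont
    (fun s hs ↦ (hderiv s hs).hasDerivWithinAt) t ⟨ht, le_rfl⟩
  simp only [N, p, l2Pairing_toLp, sub_self, sub_zero, hu.initial, Complex.ofReal_zero, zero_mul,
    Complex.exp_zero, one_mul] at hconst
  exact hconst.symm

theorem fourier_ae_eq (hu : IsFreeSchrodingerSolution u₀ u) {t : ℝ} (ht : 0 ≤ t) :
    (𝓕 (u t) : L2Space n) =ᵐ[volume] fun ξ ↦
      Complex.exp (t * freeSymbol ξ) * (𝓕 u₀ : L2Space n) ξ := by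
  have hm : MemLp (fun ξ ↦ Complex.exp (t * freeSymbol ξ) * (𝓕 u₀ : L2Space n) ξ) 2 volume := by
    refine (Lp.memLp (𝓕 u₀ : L2Space n)).of_le ((Continuous.aestronglyMeasurable
      (by fun_prop)).mul (Lp.memLp _).1) (Eventually.of_forall fun ξ ↦ ?_)
    rw [norm_mul, norm_exp_mul_freeSymbol, one_mul]
  refine ae_eq_of_integral_contDiff_smul_eq ((Lp.memLp _).locallyIntegrable one_le_two)
    (hm.locallyIntegrable one_le_two) fun φ hφ hφc ↦ ?_
  have h := hu.integral_fourier_mul_exp_eq ht (Complex.ofRealCLM.contDiff.comp hφ)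
    (hφc.comp_left Complex.ofReal_zero)
  simp only [Function.comp_apply, Complex.ofRealCLM_apply] at h
  simp only [Complex.real_smul]
  convert h using 3 <;> ring

end IsFreeSchrodingerSolution

end Propagation

/-! ### Gaussians and Weyl operators -/

section Weyl

open Complex Matrix

/-- The inclusion of `ℝⁿ` into `ℂⁿ`. On `ℂⁿ` only the bilinear product `⬝ᵥ` is used. -/
def complexify : ℝⁿ →ₗ[ℝ] Fin n → ℂ where
  toFun x i := x i
  map_add' x y := by ext i; simp
  map_smul' r x := by ext i; simp

@[simp]
lemma complexify_apply (x : ℝⁿ) (i : Fin n) : complexify x i = x i := rfl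

@[fun_prop]
lemma continuous_complexify : Continuous (complexify : ℝⁿ → Fin n → ℂ) := by
  unfold complexify
  simp only [LinearMap.coe_mk, AddHom.coe_mk]
  fun_prop

lemma complexify_dotProduct_complexify (x y : ℝⁿ) :
    complexify x ⬝ᵥ complexify y = (inner ℝ x y : ℝ) := by
  simp [dotProduct, PiLp.inner_apply, mul_comm]

lemma complexify_dotProduct_self (x : ℝⁿ) : complexify x ⬝ᵥ complexify x = (‖x‖ : ℂ) ^ 2 := by
  rw [complexify_dotProduct_complexify, real_inner_self_eq_norm_sq, ofReal_pow]

lemma re_dotProduct_complexify_le (w : Fin n → ℂ) (x : ℝⁿ) :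
    (w ⬝ᵥ complexify x).re ≤ (∑ i, ‖w i‖) * ‖x‖ := by
  calc (w ⬝ᵥ complexify x).re ≤ ‖w ⬝ᵥ complexify x‖ := re_le_norm _
    _ ≤ ∑ i, ‖w i * x i‖ := norm_sum_le _ _
    _ ≤ ∑ i, ‖w i‖ * ‖x‖ := by
        gcongr with i
        rw [norm_mul, norm_real]
        gcongr
        exact PiLp.norm_apply_le x i
    _ = (∑ i, ‖w i‖) * ‖x‖ := (Finset.sum_mul ..).symm

/-- The complex Gaussian `ζ ↦ exp (-K ζ·ζ + w·ζ)` as an entire function on `ℂⁿ`. -/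
def gaussian (K : ℂ) (w ζ : Fin n → ℂ) : ℂ := exp (-K * (ζ ⬝ᵥ ζ) + w ⬝ᵥ ζ)

/-- The test functions: linear combinations of Gaussians that decay on `ℝⁿ`. -/
def gaussianSpan (n : ℕ) : Submodule ℂ ((Fin n → ℂ) → ℂ) :=
  Submodule.span ℂ {F | ∃ K w, 0 < K.re ∧ F = gaussian K w}

lemma gaussian_mem_gaussianSpan {K : ℂ} (hK : 0 < K.re) (w : Fin n → ℂ) :
    gaussian K w ∈ gaussianSpan n :=
  Submodule.subset_span ⟨K, w, hK, rfl⟩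

@[fun_prop]
lemma continuous_gaussian (K : ℂ) (w : Fin n → ℂ) : Continuous (gaussian K w) := by
  unfold gaussian
  fun_prop

/-- The Weyl operator formally equal to `exp (-(i/2π) a · ∇ + 2π c · ξ)` for complex `a` and `c`,
acting on entire functions. The Fourier transform turns the first summand into multiplication by
`a · x`. The scalar factor is the exponential of half the commutator of the two summands. -/
def weyl (a c : Fin n → ℂ) : ((Fin n → ℂ) → ℂ) →ₗ[ℂ] (Fin n → ℂ) → ℂ where
  toFun F ζ := exp (2 * Real.pi * (c ⬝ᵥ ζ) - I / 2 * (a ⬝ᵥ c)) * F (ζ - (I / (2 * Real.pi)) • a)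
  map_add' F G := by ext ζ; simp [mul_add]
  map_smul' r F := by ext ζ; simp; ring

lemma weyl_apply (a c : Fin n → ℂ) (F : (Fin n → ℂ) → ℂ) (ζ : Fin n → ℂ) :
    weyl a c F ζ =
      exp (2 * Real.pi * (c ⬝ᵥ ζ) - I / 2 * (a ⬝ᵥ c)) * F (ζ - (I / (2 * Real.pi)) • a) := rfl

lemma weyl_add_add (a a' c c' : Fin n → ℂ) (F : (Fin n → ℂ) → ℂ) :
    weyl (a + a') (c + c') F =
      exp (I / 2 * (a ⬝ᵥ c' - c ⬝ᵥ a')) • weyl a c (weyl a' c' F) := by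
  ext ζ
  simp only [weyl_apply, Pi.smul_apply, smul_eq_mul, ← mul_assoc, ← exp_add]
  congr 1
  · congr 1
    simp only [dotProduct_add, add_dotProduct, dotProduct_sub, dotProduct_smul, smul_eq_mul,
      dotProduct_comm c' a, dotProduct_comm c a']
    field_simp
    ring
  · rw [smul_add, sub_sub]

lemma weyl_gaussian (K : ℂ) (a c w : Fin n → ℂ) :
    weyl a c (gaussian K w) =
      exp (-(I / 2) * (a ⬝ᵥ c) + K / (4 * Real.pi ^ 2) * (a ⬝ᵥ a) - I / (2 * Real.pi) * (w ⬝ᵥ a)) •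
        gaussian K (w + (I * K / Real.pi) • a + (2 * Real.pi : ℂ) • c) := by
  ext ζ
  have hπ : (Real.pi : ℂ) ≠ 0 := by simp [Real.pi_ne_zero]
  simp only [weyl_apply, gaussian, Pi.smul_apply, smul_eq_mul, ← exp_add]
  congr 1
  simp only [add_dotProduct, sub_dotProduct, dotProduct_sub, dotProduct_smul, smul_dotProduct,
    smul_eq_mul, dotProduct_comm ζ a]
  field_simp
  ring_nf
  simp only [I_sq]
  ring

lemma weyl_mem_gaussianSpan (a c : Fin n → ℂ) {F : (Fin n → ℂ) → ℂ} (hF : F ∈ gaussianSpan n) :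
    weyl a c F ∈ gaussianSpan n := by
  have : gaussianSpan n ≤ (gaussianSpan n).comap (weyl a c) := by
    refine Submodule.span_le.2 ?_
    rintro _ ⟨K, w, hK, rfl⟩
    simp only [SetLike.mem_coe, Submodule.mem_comap, weyl_gaussian]
    exact Submodule.smul_mem _ _ (gaussian_mem_gaussianSpan hK _)
  exact this hF

lemma norm_weyl_I_smul_complexify (a c : ℝⁿ) (y : ℝ) (F : (Fin n → ℂ) → ℂ) (ξ : ℝⁿ) :
    ‖weyl ((y * I) • complexify a) ((y * I) • complexify c) F (complexify ξ)‖ =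
      ‖F (complexify (ξ + (y / (2 * Real.pi)) • a))‖ := by
  have hphase : ‖exp (2 * Real.pi * (((y * I) • complexify c) ⬝ᵥ complexify ξ) -
      I / 2 * (((y * I) • complexify a) ⬝ᵥ ((y * I) • complexify c)))‖ = 1 := by
    simp only [smul_dotProduct, dotProduct_smul, complexify_dotProduct_complexify, smul_eq_mul]
    rw [← norm_exp_ofReal_mul_I (2 * Real.pi * y * inner ℝ c ξ + y ^ 2 / 2 * inner ℝ a c)]
    congr 2
    push_cast
    ring_nf
    simp only [I_pow_three]
    ring
  have hshift : complexify ξ - (I / (2 * Real.pi)) • (y * I) • complexify a =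
      complexify (ξ + (y / (2 * Real.pi)) • a) := by
    ext i
    simp only [Pi.sub_apply, Pi.smul_apply, complexify_apply, smul_eq_mul, PiLp.add_apply,
      PiLp.smul_apply, ofReal_add, ofReal_mul, ofReal_div]
    field_simp
    simp only [I_sq]
    push_cast
    ring
  rw [weyl_apply, norm_mul, hphase, one_mul, hshift]

lemma eLpNorm_weyl_I_smul_complexify (a c : ℝⁿ) (y : ℝ) {F : (Fin n → ℂ) → ℂ}
    (hF : AEStronglyMeasurable (F ∘ complexify : ℝⁿ → ℂ)) :
    eLpNorm (weyl ((y * I) • complexify a) ((y * I) • complexify c) F ∘ complexify : ℝⁿ → ℂ) 2 =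
      eLpNorm (F ∘ complexify : ℝⁿ → ℂ) 2 := by
  rw [← eLpNorm_comp_measurePreserving hF
    (measurePreserving_add_right volume ((y / (2 * Real.pi)) • a))]
  exact eLpNorm_congr_norm_ae (.of_forall fun ξ ↦ norm_weyl_I_smul_complexify a c y F ξ)

/-- The multiplier `exp (-4π² i t ζ·ζ)` of the free evolution, as an entire function. -/
def freeMultiplier (t : ℝ) (ζ : Fin n → ℂ) : ℂ := exp (-(4 * Real.pi ^ 2 * I * t) * (ζ ⬝ᵥ ζ))

lemma freeMultiplier_complexify (t : ℝ) (ξ : ℝⁿ) :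
    freeMultiplier t (complexify ξ) = exp (t * freeSymbol ξ) := by
  rw [freeMultiplier, freeSymbol, complexify_dotProduct_self]
  ring_nf

lemma freeMultiplier_neg_mul (t : ℝ) (ζ : Fin n → ℂ) :
    freeMultiplier (-t) ζ * freeMultiplier t ζ = 1 := by
  rw [freeMultiplier, freeMultiplier, ← exp_add, ← exp_zero]
  congr 1
  push_cast
  ring

lemma freeMultiplier_mul_mem_gaussianSpan (t : ℝ) {F : (Fin n → ℂ) → ℂ}
    (hF : F ∈ gaussianSpan n) : freeMultiplier t * F ∈ gaussianSpan n := by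
  have : gaussianSpan n ≤ (gaussianSpan n).comap (LinearMap.mulLeft ℂ (freeMultiplier t)) := by
    refine Submodule.span_le.2 ?_
    rintro _ ⟨K, w, hK, rfl⟩
    have hmul : freeMultiplier t * gaussian K w = gaussian (K + 4 * Real.pi ^ 2 * I * t) w := by
      ext ζ
      rw [Pi.mul_apply, freeMultiplier, gaussian, gaussian, ← exp_add]
      ring_nf
    simp only [SetLike.mem_coe, Submodule.mem_comap, LinearMap.mulLeft_apply, hmul]
    refine gaussian_mem_gaussianSpan ?_ w
    simpa [← ofReal_pow] using hK
  exact this hF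

lemma weyl_freeMultiplier_mul (t : ℝ) (a c : Fin n → ℂ) (F : (Fin n → ℂ) → ℂ) :
    weyl a (c + (2 * t : ℂ) • a) (freeMultiplier t * F) = freeMultiplier t * weyl a c F := by
  ext ζ
  have hπ : (Real.pi : ℂ) ≠ 0 := by simp [Real.pi_ne_zero]
  simp only [weyl_apply, freeMultiplier, Pi.mul_apply, ← mul_assoc, ← exp_add]
  congr 2
  simp only [add_dotProduct, dotProduct_add, sub_dotProduct, dotProduct_sub, dotProduct_smul,
    smul_dotProduct, smul_eq_mul, dotProduct_comm ζ a]
  field_simp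
  ring_nf
  simp only [I_sq, I_pow_three]
  ring

end Weyl

section ComplexAnalysis

open Complex Complex.HadamardThreeLines Metric Filter Topology

variable {E : Type*} [NormedAddCommGroup E] [NormedSpace ℂ E]

/-- Cauchy's estimate turns a local domination of the integrand into one of its derivative. -/
lemma differentiable_integral_of_dominated {α : Type*} [MeasurableSpace α] {μ : Measure α}
    {f : ℂ → α → E} (hmeas : ∀ z, AEStronglyMeasurable (f z) μ)
    (hdiff : ∀ x, Differentiable ℂ fun z ↦ f z x)
    (hdom : ∀ R : ℝ, ∃ g : α → ℝ, Integrable g μ ∧ ∀ z, ‖z‖ ≤ R → ∀ x, ‖f z x‖ ≤ g x) :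
    Differentiable ℂ fun z ↦ ∫ x, f z x ∂μ := by
  intro z₀
  obtain ⟨g, hg, hfg⟩ := hdom (‖z₀‖ + 2)
  have hderiv_meas : AEStronglyMeasurable (fun x ↦ deriv (fun z ↦ f z x) z₀) μ := by
    have hseq : Tendsto (fun k : ℕ ↦ z₀ + 1 / ((k : ℂ) + 1)) atTop (𝓝[≠] z₀) := by
      refine tendsto_nhdsWithin_iff.2 ⟨?_, .of_forall fun k ↦ ?_⟩
      · simpa using (tendsto_one_div_add_atTop_nhds_zero_nat (𝕜 := ℂ)).const_add z₀
      · simpa using Nat.cast_add_one_ne_zero k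
    refine aestronglyMeasurable_of_tendsto_ae atTop (fun k ↦ ?_) (.of_forall fun x ↦
      (hasDerivAt_iff_tendsto_slope.1 (hdiff x z₀).hasDerivAt).comp hseq)
    exact ((hmeas _).sub (hmeas z₀)).const_smul _
  have hderiv_le : ∀ x, ∀ z ∈ ball z₀ 1, ‖deriv (fun z ↦ f z x) z‖ ≤ g x := by
    intro x z hz
    have hle : ∀ w ∈ sphere z 1, ‖f w x‖ ≤ g x := by
      intro w hw
      refine hfg w ?_ x
      have h₁ : ‖w - z‖ = 1 := by rwa [mem_sphere_iff_norm] at hw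
      have h₂ : ‖z - z₀‖ < 1 := by rwa [mem_ball_iff_norm] at hz
      calc ‖w‖ = ‖z₀ + (z - z₀) + (w - z)‖ := by congr 1; abel
        _ ≤ ‖z₀‖ + ‖z - z₀‖ + ‖w - z‖ := norm_add₃_le
        _ ≤ ‖z₀‖ + 2 := by linarith
    simpa using norm_deriv_le_of_forall_mem_sphere_norm_le one_pos (hdiff x).diffContOnCl hle
  exact (hasDerivAt_integral_of_dominated_loc_of_deriv_le (ball_mem_nhds z₀ one_pos)
    (.of_forall hmeas) (hg.mono' (hmeas z₀) (.of_forall (hfg z₀ (by linarith))))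
    hderiv_meas (.of_forall hderiv_le) hg
    (.of_forall fun x z _ ↦ (hdiff x z).hasDerivAt)).2.differentiableAt

lemma norm_exp_mul_sq_smul (ε : ℝ) (w : ℂ) (v : E) :
    ‖exp (ε * w ^ 2) • v‖ = Real.exp (ε * (w.re ^ 2 - w.im ^ 2)) * ‖v‖ := by
  rw [norm_smul, norm_exp, re_ofReal_mul, sq w, mul_re, ← sq, ← sq]

lemma norm_exp_mul_sq_smul_le_of_exp_growth {B C ε : ℝ} (hε : 0 < ε) {w : ℂ}
    (hw : w ∈ verticalClosedStrip 0 1) {v : E} (hv : ‖v‖ ≤ C * Real.exp (B * |w.im|)) :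
    ‖exp (ε * w ^ 2) • v‖ ≤ Real.exp (ε + B ^ 2 / (4 * ε)) * |C| := by
  have hexp : ε * (w.re ^ 2 - w.im ^ 2) + B * |w.im| ≤ ε + B ^ 2 / (4 * ε) := by
    have hre : w.re ^ 2 ≤ 1 := pow_le_one₀ hw.1 hw.2
    have hsq : ε * (|w.im| - B / (2 * ε)) ^ 2 =
        ε * w.im ^ 2 - B * |w.im| + B ^ 2 / (4 * ε) := by
      rw [← sq_abs w.im]
      field_simp
      ring
    nlinarith [mul_nonneg hε.le (sq_nonneg (|w.im| - B / (2 * ε)))]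
  calc ‖exp (ε * w ^ 2) • v‖
      ≤ Real.exp (ε * (w.re ^ 2 - w.im ^ 2)) * (|C| * Real.exp (B * |w.im|)) := by
        rw [norm_exp_mul_sq_smul]
        gcongr
        exact hv.trans (by gcongr; exact le_abs_self C)
    _ = Real.exp (ε * (w.re ^ 2 - w.im ^ 2) + B * |w.im|) * |C| := by
        rw [Real.exp_add]; ring
    _ ≤ Real.exp (ε + B ^ 2 / (4 * ε)) * |C| := by gcongr

/-- The factor `exp (ε z²)` makes the function bounded on the strip; then `ε` tends to `0`. -/
lemma norm_le_interp_of_exp_growth {f : ℂ → E} {B C M₀ M₁ : ℝ} {z : ℂ}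
    (hf : DiffContOnCl ℂ f (verticalStrip 0 1))
    (hgrowth : ∀ w ∈ verticalClosedStrip 0 1, ‖f w‖ ≤ C * Real.exp (B * |w.im|))
    (h₀ : ∀ w ∈ re ⁻¹' {0}, ‖f w‖ ≤ M₀) (h₁ : ∀ w ∈ re ⁻¹' {1}, ‖f w‖ ≤ M₁)
    (hz : z ∈ verticalClosedStrip 0 1) :
    ‖f z‖ ≤ M₀ ^ (1 - z.re) * M₁ ^ z.re := by
  have hε : ∀ ε > 0, Real.exp (ε * (z.re ^ 2 - z.im ^ 2)) * ‖f z‖ ≤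
      M₀ ^ (1 - z.re) * (Real.exp ε * M₁) ^ z.re := by
    intro ε hε
    rw [← norm_exp_mul_sq_smul]
    have hdiff : Differentiable ℂ fun w : ℂ ↦ exp (ε * w ^ 2) := by fun_prop
    refine norm_le_interp_of_mem_verticalClosedStrip₀₁' (fun w ↦ exp (ε * w ^ 2) • f w) hz
      (hdiff.diffContOnCl.smul hf) ?_ ?_ ?_
    · refine ⟨Real.exp (ε + B ^ 2 / (4 * ε)) * |C|, ?_⟩
      rintro _ ⟨w, hw, rfl⟩
      exact norm_exp_mul_sq_smul_le_of_exp_growth hε hw (hgrowth w hw)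
    · intro w hw
      rw [norm_exp_mul_sq_smul, show w.re = 0 from hw]
      refine (mul_le_of_le_one_left (norm_nonneg _) ?_).trans (h₀ w hw)
      exact Real.exp_le_one_iff.2 (by nlinarith [sq_nonneg w.im])
    · intro w hw
      rw [norm_exp_mul_sq_smul, show w.re = 1 from hw]
      gcongr
      · nlinarith [sq_nonneg w.im]
      · exact h₁ w hw
  have hl : Continuous fun ε : ℝ ↦ Real.exp (ε * (z.re ^ 2 - z.im ^ 2)) * ‖f z‖ := by fun_prop
  have hr : Continuous fun ε : ℝ ↦ M₀ ^ (1 - z.re) * (Real.exp ε * M₁) ^ z.re :=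
    continuous_const.mul (Continuous.rpow_const (by fun_prop) fun _ ↦ .inr hz.1)
  refine le_of_tendsto_of_tendsto (b := 𝓝[>] 0)
    ((hl.tendsto' 0 _ (by simp)).mono_left nhdsWithin_le_nhds)
    ((hr.tendsto' 0 _ (by simp)).mono_left nhdsWithin_le_nhds) ?_
  filter_upwards [self_mem_nhdsWithin] with ε hε' using hε ε hε'

end ComplexAnalysis

section Decay

open Complex Matrix

section

variable {V : Type*} [NormedAddCommGroup V] [InnerProductSpace ℝ V] [FiniteDimensional ℝ V]
  [MeasurableSpace V] [BorelSpace V]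

lemma integrable_exp_neg_mul_norm_sq {κ : ℝ} (hκ : 0 < κ) :
    Integrable fun x : V ↦ Real.exp (-κ * ‖x‖ ^ 2) := by
  have h := (GaussianFourier.integrable_cexp_neg_mul_sq_norm_add (V := V) (b := κ) hκ 0 0).norm
  refine h.congr (.of_forall fun x ↦ ?_)
  simp [norm_exp, ← ofReal_pow]

lemma memLp_exp_neg_mul_norm_sq {κ : ℝ} (hκ : 0 < κ) :
    MemLp (fun x : V ↦ Real.exp (-κ * ‖x‖ ^ 2)) 2 volume := by
  rw [memLp_two_iff_integrable_sq (by fun_prop)]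
  refine (integrable_exp_neg_mul_norm_sq (mul_pos two_pos hκ)).congr (.of_forall fun x ↦ ?_)
  simp only [← Real.exp_nat_mul]
  congr 1
  push_cast
  ring

end

lemma norm_gaussian_le {K : ℂ} (hK : 0 < K.re) (w : Fin n → ℂ) (x : ℝⁿ) :
    ‖gaussian K w (complexify x)‖ ≤
      Real.exp ((∑ i, ‖w i‖) ^ 2 / (2 * K.re)) * Real.exp (-(K.re / 2) * ‖x‖ ^ 2) := by
  rw [gaussian, norm_exp, ← Real.exp_add, Real.exp_le_exp, complexify_dotProduct_self, add_re,
    ← ofReal_pow, re_mul_ofReal, neg_re]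
  have hw := re_dotProduct_complexify_le w x
  set s := ∑ i, ‖w i‖
  have hsq : K.re / 2 * (‖x‖ - s / K.re) ^ 2 =
      K.re / 2 * ‖x‖ ^ 2 - s * ‖x‖ + s ^ 2 / (2 * K.re) := by
    field_simp
    ring
  nlinarith [mul_nonneg (half_pos hK).le (sq_nonneg (‖x‖ - s / K.re))]

lemma exists_norm_weyl_gaussian_le {X : Type*} [TopologicalSpace X] {S : Set X}
    (hS : IsCompact S) {a c : X → Fin n → ℂ} (ha : Continuous a) (hc : Continuous c) {K : ℂ}
    (hK : 0 < K.re) (w : Fin n → ℂ) :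
    ∃ C : ℝ, ∀ z ∈ S, ∀ x : ℝⁿ,
      ‖weyl (a z) (c z) (gaussian K w) (complexify x)‖ ≤ C * Real.exp (-(K.re / 2) * ‖x‖ ^ 2) := by
  let w' (z : X) : Fin n → ℂ := w + (I * K / Real.pi) • a z + (2 * Real.pi : ℂ) • c z
  let A (z : X) : ℂ := exp (-(I / 2) * (a z ⬝ᵥ c z) + K / (4 * Real.pi ^ 2) * (a z ⬝ᵥ a z) -
    I / (2 * Real.pi) * (w ⬝ᵥ a z))
  have hcont : Continuous fun z ↦ ‖A z‖ * Real.exp ((∑ i, ‖w' z i‖) ^ 2 / (2 * K.re)) := by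
    fun_prop
  obtain ⟨C, hC⟩ := hS.exists_bound_of_continuousOn hcont.continuousOn
  refine ⟨C, fun z hz x ↦ ?_⟩
  rw [weyl_gaussian, Pi.smul_apply, norm_smul]
  calc ‖A z‖ * ‖gaussian K (w' z) (complexify x)‖
      ≤ ‖A z‖ * (Real.exp ((∑ i, ‖w' z i‖) ^ 2 / (2 * K.re)) *
          Real.exp (-(K.re / 2) * ‖x‖ ^ 2)) := by gcongr; exact norm_gaussian_le hK _ x
    _ = ‖A z‖ * Real.exp ((∑ i, ‖w' z i‖) ^ 2 / (2 * K.re)) *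
          Real.exp (-(K.re / 2) * ‖x‖ ^ 2) := (mul_assoc ..).symm
    _ ≤ C * Real.exp (-(K.re / 2) * ‖x‖ ^ 2) := by
        gcongr
        exact (le_abs_self _).trans (hC z hz)

lemma exists_norm_weyl_le {X : Type*} [TopologicalSpace X] {S : Set X} (hS : IsCompact S)
    {a c : X → Fin n → ℂ} (ha : Continuous a) (hc : Continuous c) {F : (Fin n → ℂ) → ℂ}
    (hF : F ∈ gaussianSpan n) :
    ∃ C κ : ℝ, 0 ≤ C ∧ 0 < κ ∧ ∀ z ∈ S, ∀ x : ℝⁿ,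
      ‖weyl (a z) (c z) F (complexify x)‖ ≤ C * Real.exp (-κ * ‖x‖ ^ 2) := by
  induction hF using Submodule.span_induction with
  | mem _ h =>
    obtain ⟨K, w, hK, rfl⟩ := h
    obtain ⟨C, hC⟩ := exists_norm_weyl_gaussian_le hS ha hc hK w
    refine ⟨|C|, K.re / 2, abs_nonneg C, half_pos hK, fun z hz x ↦ (hC z hz x).trans ?_⟩
    gcongr
    exact le_abs_self C
  | zero => exact ⟨0, 1, le_rfl, one_pos, fun z _ x ↦ by simp⟩
  | add F G _ _ hF hG =>
    obtain ⟨C, κ, hC, hκ, hF⟩ := hF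
    obtain ⟨D, δ, hD, hδ, hG⟩ := hG
    refine ⟨C + D, min κ δ, by positivity, lt_min hκ hδ, fun z hz x ↦ ?_⟩
    rw [map_add, Pi.add_apply, add_mul]
    refine (norm_add_le _ _).trans (add_le_add ((hF z hz x).trans ?_) ((hG z hz x).trans ?_))
    · gcongr
      exact min_le_left κ δ
    · gcongr
      exact min_le_right κ δ
  | smul r F _ hF =>
    obtain ⟨C, κ, hC, hκ, hF⟩ := hF
    refine ⟨‖r‖ * C, κ, by positivity, hκ, fun z hz x ↦ ?_⟩
    rw [map_smul, Pi.smul_apply, norm_smul, mul_assoc]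
    gcongr
    exact hF z hz x

lemma continuous_of_mem_gaussianSpan {F : (Fin n → ℂ) → ℂ} (hF : F ∈ gaussianSpan n) :
    Continuous F := by
  induction hF using Submodule.span_induction with
  | mem _ h => obtain ⟨K, w, -, rfl⟩ := h; exact continuous_gaussian K w
  | zero => exact continuous_const
  | add F G _ _ hF hG => exact hF.add hG
  | smul r F _ hF => exact hF.const_smul r

lemma exists_norm_le_of_mem_gaussianSpan {F : (Fin n → ℂ) → ℂ} (hF : F ∈ gaussianSpan n) :
    ∃ C κ : ℝ, 0 < κ ∧ ∀ x : ℝⁿ, ‖F (complexify x)‖ ≤ C * Real.exp (-κ * ‖x‖ ^ 2) := by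
  obtain ⟨C, κ, -, hκ, h⟩ := exists_norm_weyl_le (X := Unit) isCompact_univ
    (continuous_const (y := 0)) (continuous_const (y := 0)) hF
  exact ⟨C, κ, hκ, fun x ↦ by simpa [weyl_apply] using h () (mem_univ _) x⟩

lemma integrable_of_mem_gaussianSpan {F : (Fin n → ℂ) → ℂ} (hF : F ∈ gaussianSpan n) :
    Integrable (F ∘ complexify : ℝⁿ → ℂ) := by
  obtain ⟨C, κ, hκ, h⟩ := exists_norm_le_of_mem_gaussianSpan hF
  exact ((integrable_exp_neg_mul_norm_sq hκ).const_mul C).mono'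
    ((continuous_of_mem_gaussianSpan hF).comp continuous_complexify).aestronglyMeasurable
    (.of_forall h)

lemma memLp_of_mem_gaussianSpan {F : (Fin n → ℂ) → ℂ} (hF : F ∈ gaussianSpan n) :
    MemLp (F ∘ complexify : ℝⁿ → ℂ) 2 volume := by
  obtain ⟨C, κ, hκ, h⟩ := exists_norm_le_of_mem_gaussianSpan hF
  exact ((memLp_exp_neg_mul_norm_sq hκ).const_mul C).mono'
    ((continuous_of_mem_gaussianSpan hF).comp continuous_complexify).aestronglyMeasurable
    (.of_forall h)

end Decay

/-! ### Interpolation of Weyl operators -/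

section Interpolation

open Complex Complex.HadamardThreeLines Matrix

/-- The transpose of the Weyl operator with real parameters `a` and `c` maps `v` to a function of
`L²` norm at most `M`. This is stated by duality because the operator is unbounded. -/
def WeylBound (v : ℝⁿ → ℂ) (a c : ℝⁿ) (M : ℝ) : Prop :=
  ∀ F ∈ gaussianSpan n, ‖∫ ξ, v ξ * weyl (complexify a) (complexify c) F (complexify ξ)‖ ≤
    M * (eLpNorm (F ∘ complexify : ℝⁿ → ℂ) 2).toReal

/-- Conjugation with the free evolution maps `x` to `x + 2tp`. -/
lemma weylBound_free_iff {v₀ vt : ℝⁿ → ℂ} {a c : ℝⁿ} {t M : ℝ}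
    (h : vt =ᵐ[volume] fun ξ ↦ exp (t * freeSymbol ξ) * v₀ ξ) :
    WeylBound vt a c M ↔ WeylBound v₀ a (c + (2 * t) • a) M := by
  have hc : complexify (c + (2 * t) • a) = complexify c + (2 * t : ℂ) • complexify a := by
    ext i
    simp
  have hint (F : (Fin n → ℂ) → ℂ) :
      ∫ ξ, v₀ ξ * weyl (complexify a) (complexify (c + (2 * t) • a)) (freeMultiplier t * F)
        (complexify ξ) = ∫ ξ, vt ξ * weyl (complexify a) (complexify c) F (complexify ξ) := by
    refine integral_congr_ae ?_
    filter_upwards [h] with ξ hξ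
    rw [hξ, hc, weyl_freeMultiplier_mul, Pi.mul_apply, freeMultiplier_complexify]
    ring
  have hnorm (F : (Fin n → ℂ) → ℂ) :
      eLpNorm ((freeMultiplier t * F) ∘ complexify : ℝⁿ → ℂ) 2 volume =
        eLpNorm (F ∘ complexify : ℝⁿ → ℂ) 2 volume := by
    refine eLpNorm_congr_norm_ae (.of_forall fun ξ ↦ ?_)
    rw [Function.comp_apply, Pi.mul_apply, freeMultiplier_complexify, norm_mul,
      norm_exp_mul_freeSymbol, one_mul, Function.comp_apply]
  constructor
  · intro hb F hF
    obtain ⟨G, hG, rfl⟩ : ∃ G ∈ gaussianSpan n, F = freeMultiplier t * G := by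
      refine ⟨_, freeMultiplier_mul_mem_gaussianSpan (-t) hF, ?_⟩
      ext ζ
      rw [Pi.mul_apply, Pi.mul_apply, ← mul_assoc, mul_comm (freeMultiplier t ζ),
        freeMultiplier_neg_mul, one_mul]
    rw [hint, hnorm]
    exact hb G hG
  · intro hb F hF
    rw [← hint, ← hnorm]
    exact hb _ (freeMultiplier_mul_mem_gaussianSpan t hF)

lemma integrable_mul_weyl {v : ℝⁿ → ℂ} {F : (Fin n → ℂ) → ℂ} (hv : MemLp v 2 volume)
    (hF : F ∈ gaussianSpan n) (a c : Fin n → ℂ) :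
    Integrable fun ξ : ℝⁿ ↦ v ξ * weyl a c F (complexify ξ) :=
  hv.integrable_mul (memLp_of_mem_gaussianSpan (weyl_mem_gaussianSpan a c hF))

/-- The pairing of `v` with the Weyl operators along the complex line through `(a, c)` in the
direction `(b, d)`. -/
def weylPairing (v : ℝⁿ → ℂ) (F : (Fin n → ℂ) → ℂ) (a b c d : ℝⁿ) (z : ℂ) : ℂ :=
  ∫ ξ, v ξ * weyl (complexify a + z • complexify b) (complexify c + z • complexify d) F
    (complexify ξ)

lemma weylPairing_ofReal (v : ℝⁿ → ℂ) (F : (Fin n → ℂ) → ℂ) (a b c d : ℝⁿ) (x : ℝ) :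
    weylPairing v F a b c d x = ∫ ξ, v ξ *
      weyl (complexify (a + x • b)) (complexify (c + x • d)) F (complexify ξ) := by
  have hline (a b : ℝⁿ) : complexify (a + x • b) = complexify a + (x : ℂ) • complexify b := by
    ext i
    simp
  rw [weylPairing, hline, hline]

lemma differentiable_weyl_line {F : (Fin n → ℂ) → ℂ} (hF : F ∈ gaussianSpan n)
    (a b c d ζ : Fin n → ℂ) : Differentiable ℂ fun z : ℂ ↦ weyl (a + z • b) (c + z • d) F ζ := by
  induction hF using Submodule.span_induction with
  | mem _ h =>
    obtain ⟨K, w, -, rfl⟩ := h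
    simp only [weyl_apply, gaussian, dotProduct]
    fun_prop
  | zero => simp
  | add F G _ _ hF hG => simp only [map_add, Pi.add_apply]; exact hF.add hG
  | smul r F _ hF => simp only [map_smul, Pi.smul_apply]; exact hF.const_smul r

lemma differentiable_weylPairing {v : ℝⁿ → ℂ} {F : (Fin n → ℂ) → ℂ} (hv : MemLp v 2 volume)
    (hF : F ∈ gaussianSpan n) (a b c d : ℝⁿ) : Differentiable ℂ (weylPairing v F a b c d) := by
  refine differentiable_integral_of_dominated (fun z ↦ (integrable_mul_weyl hv hF _ _).1)
    (fun ξ ↦ (differentiable_weyl_line hF _ _ _ _ _).const_mul _) fun R ↦ ?_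
  obtain ⟨C, κ, -, hκ, hC⟩ := exists_norm_weyl_le (isCompact_closedBall (0 : ℂ) R)
    (a := fun z ↦ complexify a + z • complexify b) (c := fun z ↦ complexify c + z • complexify d)
    (by fun_prop) (by fun_prop) hF
  refine ⟨fun ξ ↦ ‖v ξ‖ * (C * Real.exp (-κ * ‖ξ‖ ^ 2)),
    hv.norm.integrable_mul ((memLp_exp_neg_mul_norm_sq hκ).const_mul C), fun z hz ξ ↦ ?_⟩
  rw [norm_mul]
  exact mul_le_mul_of_nonneg_left (hC z (mem_closedBall_zero_iff.2 hz) ξ) (norm_nonneg _)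

lemma complexify_add_smul_complexify (a b : ℝⁿ) (z : ℂ) :
    complexify a + z • complexify b = complexify (a + z.re • b) + (z.im * I) • complexify b := by
  ext i
  simp only [Pi.add_apply, Pi.smul_apply, complexify_apply, PiLp.add_apply, PiLp.smul_apply,
    smul_eq_mul, ofReal_add, ofReal_mul]
  linear_combination -(b i : ℂ) * re_add_im z

lemma weyl_line_eq_smul_weyl_weyl (F : (Fin n → ℂ) → ℂ) (a b c d : ℝⁿ) (z : ℂ) :
    weyl (complexify a + z • complexify b) (complexify c + z • complexify d) F =
      exp (-(z.im / 2 * (inner ℝ a d - inner ℝ c b)) : ℝ) •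
        weyl (complexify (a + z.re • b)) (complexify (c + z.re • d))
          (weyl ((z.im * I) • complexify b) ((z.im * I) • complexify d) F) := by
  rw [complexify_add_smul_complexify a, complexify_add_smul_complexify c, weyl_add_add]
  congr 2
  simp only [dotProduct_smul, complexify_dotProduct_complexify, inner_add_left,
    real_inner_smul_left, real_inner_comm b d, smul_eq_mul]
  push_cast
  ring_nf
  simp only [I_sq]
  ring

lemma weyl_line_eq_smul_weyl_weyl' (F : (Fin n → ℂ) → ℂ) (a b c d : ℝⁿ) (z : ℂ) :
    weyl (complexify a + z • complexify b) (complexify c + z • complexify d) F =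
      exp (z.im / 2 * (inner ℝ a d - inner ℝ c b) : ℝ) •
        weyl ((z.im * I) • complexify b) ((z.im * I) • complexify d)
          (weyl (complexify (a + z.re • b)) (complexify (c + z.re • d)) F) := by
  rw [complexify_add_smul_complexify a, complexify_add_smul_complexify c, add_comm (complexify _),
    add_comm (complexify (c + _)), weyl_add_add]
  congr 2
  simp only [smul_dotProduct, complexify_dotProduct_complexify, inner_add_right,
    real_inner_smul_right, real_inner_comm b d, real_inner_comm a d, real_inner_comm c b,
    smul_eq_mul]
  push_cast
  ring_nf
  simp only [I_sq]
  ring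

lemma exists_norm_weylPairing_le {v : ℝⁿ → ℂ} {F : (Fin n → ℂ) → ℂ} (hv : MemLp v 2 volume)
    (hF : F ∈ gaussianSpan n) (a b c d : ℝⁿ) : ∃ C, ∀ z ∈ verticalClosedStrip 0 1,
    ‖weylPairing v F a b c d z‖ ≤
      C * Real.exp (z.im / 2 * (inner ℝ a d - inner ℝ c b)) := by
  obtain ⟨C, κ, -, hκ, hC⟩ := exists_norm_weyl_le (isCompact_Icc (a := (0 : ℝ)) (b := 1))
    (a := fun x ↦ complexify (a + x • b)) (c := fun x ↦ complexify (c + x • d))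
    (by fun_prop) (by fun_prop) hF
  have hE : MemLp (fun ξ : ℝⁿ ↦ C * Real.exp (-κ * ‖ξ‖ ^ 2)) 2 volume :=
    (memLp_exp_neg_mul_norm_sq hκ).const_mul C
  refine ⟨(eLpNorm v 2 volume).toReal *
    (eLpNorm (fun ξ : ℝⁿ ↦ C * Real.exp (-κ * ‖ξ‖ ^ 2)) 2 volume).toReal, fun z hz ↦ ?_⟩
  let G := weyl (complexify (a + z.re • b)) (complexify (c + z.re • d)) F
  have hG : G ∈ gaussianSpan n := weyl_mem_gaussianSpan _ _ hF
  have hle : eLpNorm (G ∘ complexify : ℝⁿ → ℂ) 2 volume ≤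
      eLpNorm (fun ξ : ℝⁿ ↦ C * Real.exp (-κ * ‖ξ‖ ^ 2)) 2 volume :=
    eLpNorm_mono_real fun ξ ↦ hC z.re hz ξ
  have hpair := norm_integral_mul_le hv (memLp_of_mem_gaussianSpan (weyl_mem_gaussianSpan
    ((z.im * I) • complexify b) ((z.im * I) • complexify d) hG))
  rw [eLpNorm_weyl_I_smul_complexify b d z.im (memLp_of_mem_gaussianSpan hG).1] at hpair
  simp only [weylPairing, weyl_line_eq_smul_weyl_weyl', Pi.smul_apply, smul_eq_mul,
    mul_left_comm _ (exp _), integral_const_mul, norm_mul, norm_exp_ofReal]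
  rw [mul_comm]
  gcongr
  refine hpair.trans ?_
  gcongr
  exact hE.2.ne

lemma WeylBound.norm_weylPairing_le {v : ℝⁿ → ℂ} {F : (Fin n → ℂ) → ℂ} {a b c d : ℝⁿ} {M : ℝ}
    {z : ℂ} (h : WeylBound v (a + z.re • b) (c + z.re • d) M) (hF : F ∈ gaussianSpan n) :
    ‖weylPairing v F a b c d z‖ ≤ Real.exp (-(z.im / 2 * (inner ℝ a d - inner ℝ c b))) *
      (M * (eLpNorm (F ∘ complexify : ℝⁿ → ℂ) 2).toReal) := by
  have hz := h _ (weyl_mem_gaussianSpan ((z.im * I) • complexify b) ((z.im * I) • complexify d) hF)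
  rw [eLpNorm_weyl_I_smul_complexify b d z.im (memLp_of_mem_gaussianSpan hF).1] at hz
  simp only [weylPairing, weyl_line_eq_smul_weyl_weyl, Pi.smul_apply, smul_eq_mul,
    mul_left_comm _ (exp _), integral_const_mul, norm_mul, norm_exp_ofReal]
  gcongr

lemma mul_rpow_mul_mul_rpow {A B N : ℝ} (hA : 0 ≤ A) (hB : 0 ≤ B) (hN : 0 ≤ N) (x : ℝ) :
    (A * N) ^ (1 - x) * (B * N) ^ x = A ^ (1 - x) * B ^ x * N := by
  rw [Real.mul_rpow hA hN, Real.mul_rpow hB hN, mul_mul_mul_comm, ← Real.rpow_add' hN (by simp),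
    sub_add_cancel, Real.rpow_one]

/-- The factor `exp (-iωz/2)` compensates the cocycle by which Weyl operators fail to commute. -/
theorem WeylBound.interp {v : ℝⁿ → ℂ} (hv : MemLp v 2 volume) {a₀ a₁ c₀ c₁ : ℝⁿ}
    {M₀ M₁ x : ℝ} (hM₀ : 0 ≤ M₀) (hM₁ : 0 ≤ M₁) (h₀ : WeylBound v a₀ c₀ M₀)
    (h₁ : WeylBound v a₁ c₁ M₁) (hx₀ : 0 ≤ x) (hx₁ : x ≤ 1) :
    WeylBound v (a₀ + x • (a₁ - a₀)) (c₀ + x • (c₁ - c₀)) (M₀ ^ (1 - x) * M₁ ^ x) := by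
  intro F hF
  set N := (eLpNorm (F ∘ complexify : ℝⁿ → ℂ) 2 volume).toReal
  set ω : ℝ := inner ℝ a₀ (c₁ - c₀) - inner ℝ c₀ (a₁ - a₀)
  let Φ := weylPairing v F a₀ (a₁ - a₀) c₀ (c₁ - c₀)
  let Ψ (z : ℂ) : ℂ := exp (-(I * ω / 2) * z) * Φ z
  have hΨ (z : ℂ) : ‖Ψ z‖ = Real.exp (z.im / 2 * ω) * ‖Φ z‖ := by
    rw [norm_mul, norm_exp]
    congr 2
    simp
    ring
  have hdiff : Differentiable ℂ Ψ :=
    Differentiable.mul (by fun_prop) (differentiable_weylPairing hv hF _ _ _ _)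
  obtain ⟨C, hC⟩ := exists_norm_weylPairing_le hv hF a₀ (a₁ - a₀) c₀ (c₁ - c₀)
  have hgrowth : ∀ z ∈ verticalClosedStrip 0 1, ‖Ψ z‖ ≤ |C| * Real.exp (|ω| * |z.im|) := by
    intro z hz
    calc ‖Ψ z‖ ≤ Real.exp (z.im / 2 * ω) * (C * Real.exp (z.im / 2 * ω)) := by
          rw [hΨ]
          gcongr
          exact hC z hz
      _ = C * Real.exp (ω * z.im) := by rw [mul_left_comm, ← Real.exp_add]; ring_nf
      _ ≤ |C| * Real.exp (|ω| * |z.im|) := by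
          rw [← abs_mul]
          gcongr <;> exact le_abs_self _
  have hedge {M : ℝ} {z : ℂ}
      (h : WeylBound v (a₀ + z.re • (a₁ - a₀)) (c₀ + z.re • (c₁ - c₀)) M) : ‖Ψ z‖ ≤ M * N := by
    rw [hΨ, ← le_div_iff₀' (Real.exp_pos _), div_eq_inv_mul, ← Real.exp_neg]
    exact h.norm_weylPairing_le hF
  have key := norm_le_interp_of_exp_growth (z := x) hdiff.diffContOnCl hgrowth
    (fun z hz ↦ hedge (M := M₀) (by simpa [show z.re = 0 from hz] using h₀))
    (fun z hz ↦ hedge (M := M₁) (by simpa [show z.re = 1 from hz] using h₁)) ⟨hx₀, hx₁⟩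
  calc _ = ‖Ψ x‖ := by rw [hΨ, ← weylPairing_ofReal]; simp [Φ]
    _ ≤ (M₀ * N) ^ (1 - x) * (M₁ * N) ^ x := key
    _ = M₀ ^ (1 - x) * M₁ ^ x * N := mul_rpow_mul_mul_rpow hM₀ hM₁ ENNReal.toReal_nonneg x

end Interpolation

/-! ### Exponential weights -/

section Weights

open Complex Matrix InnerProductSpace

lemma exists_norm_le_forall_eq_inner {𝕜 E H : Type*} [RCLike 𝕜] [AddCommGroup E] [Module 𝕜 E]
    [NormedAddCommGroup H] [InnerProductSpace 𝕜 H] [CompleteSpace H] (e : E →ₗ[𝕜] H)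
    (l : E →ₗ[𝕜] 𝕜) {M : ℝ} (hM : 0 ≤ M) (hl : ∀ x, ‖l x‖ ≤ M * ‖e x‖) :
    ∃ h : H, ‖h‖ ≤ M ∧ ∀ x, l x = inner 𝕜 h (e x) := by
  obtain ⟨σ, hσ⟩ := e.rangeRestrict.exists_rightInverse_of_surjective e.range_rangeRestrict
  have heσ (y : LinearMap.range e) : e (σ y) = y := congrArg Subtype.val (LinearMap.congr_fun hσ y)
  have hlσ (x : E) : l (σ (e.rangeRestrict x)) = l x := by
    have h := hl (σ (e.rangeRestrict x) - x)
    rw [map_sub, map_sub, heσ, show (e.rangeRestrict x : H) = e x from rfl, sub_self, norm_zero,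
      mul_zero] at h
    exact sub_eq_zero.1 (norm_le_zero_iff.1 h)
  obtain ⟨g, hg, hgnorm⟩ := exists_extension_norm_eq (LinearMap.range e)
    ((l ∘ₗ σ).mkContinuous M fun y ↦ (hl (σ y)).trans_eq (by rw [heσ, Submodule.coe_norm]))
  refine ⟨(toDual 𝕜 H).symm g, ?_, fun x ↦ ?_⟩
  · rw [LinearIsometryEquiv.norm_map, hgnorm]
    exact LinearMap.mkContinuous_norm_le _ hM _
  · rw [toDual_symm_apply]
    exact (hlσ x).symm.trans (hg (e.rangeRestrict x)).symm

lemma integral_gaussian_complexify {K : ℂ} (hK : 0 < K.re) (w : Fin n → ℂ) :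
    ∫ x : ℝⁿ, gaussian K w (complexify x) =
      (Real.pi / K) ^ (n / 2 : ℂ) * exp ((w ⬝ᵥ w) / (4 * K)) := by
  rw [← (PiLp.volume_preserving_toLp (Fin n)).integral_comp
    (MeasurableEquiv.toLp 2 _).measurableEmbedding]
  have h := GaussianFourier.integral_cexp_neg_mul_sum_add hK w
  simp only [Fintype.card_fin, pow_two] at h
  exact h

lemma fourier_gaussian {K : ℂ} (hK : 0 < K.re) (w : Fin n → ℂ) (x : ℝⁿ) :
    𝓕 (gaussian K w ∘ complexify : ℝⁿ → ℂ) x = (Real.pi / K) ^ (n / 2 : ℂ) *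
      exp (((w - (2 * Real.pi * I) • complexify x) ⬝ᵥ (w - (2 * Real.pi * I) • complexify x)) /
        (4 * K)) := by
  rw [Real.fourier_eq', ← integral_gaussian_complexify hK]
  refine integral_congr_ae (.of_forall fun v ↦ ?_)
  simp only [gaussian, Function.comp_apply, smul_eq_mul, ← exp_add, sub_dotProduct,
    smul_dotProduct, complexify_dotProduct_complexify, real_inner_comm]
  congr 1
  push_cast
  ring

lemma fourier_gaussian_ne_zero {K : ℂ} (hK : 0 < K.re) (w : Fin n → ℂ) (x : ℝⁿ) :
    𝓕 (gaussian K w ∘ complexify : ℝⁿ → ℂ) x ≠ 0 := by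
  have hK₀ : K ≠ 0 := ne_zero_of_re_pos hK
  rw [fourier_gaussian hK]
  exact mul_ne_zero (cpow_ne_zero_iff.2 (.inl (div_ne_zero (ofReal_ne_zero.2 Real.pi_ne_zero) hK₀)))
    (exp_ne_zero _)

lemma fourier_weyl_zero {F : (Fin n → ℂ) → ℂ} (hF : F ∈ gaussianSpan n) (a : Fin n → ℂ) (x : ℝⁿ) :
    𝓕 (weyl a 0 F ∘ complexify : ℝⁿ → ℂ) x =
      exp (a ⬝ᵥ complexify x) * 𝓕 (F ∘ complexify : ℝⁿ → ℂ) x := by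
  induction hF using Submodule.span_induction with
  | mem _ h =>
    obtain ⟨K, w, hK, rfl⟩ := h
    have hK₀ : K ≠ 0 := ne_zero_of_re_pos hK
    have hweyl : (weyl a 0 (gaussian K w) ∘ complexify : ℝⁿ → ℂ) =
        exp (K / (4 * Real.pi ^ 2) * (a ⬝ᵥ a) - I / (2 * Real.pi) * (w ⬝ᵥ a)) •
          (gaussian K (w + (I * K / Real.pi) • a) ∘ complexify) := by
      rw [weyl_gaussian]
      ext ξ
      simp
    rw [hweyl, fourier_const_smul, Pi.smul_apply, smul_eq_mul, fourier_gaussian hK,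
      fourier_gaussian hK, mul_left_comm, mul_left_comm (exp (_ ⬝ᵥ _)), ← exp_add, ← exp_add]
    congr 2
    simp only [add_dotProduct, dotProduct_add, sub_dotProduct, dotProduct_sub, smul_dotProduct,
      dotProduct_smul, smul_eq_mul, dotProduct_comm a w, dotProduct_comm (complexify x) a]
    field_simp
    ring_nf
    simp only [I_sq]
    ring
  | zero => simp [Real.fourier_eq']
  | add F G hF' hG' hF hG =>
    rw [map_add, Pi.add_comp, Pi.add_comp,
      fourier_add_of_integrable (integrable_of_mem_gaussianSpan (weyl_mem_gaussianSpan a 0 hF'))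
        (integrable_of_mem_gaussianSpan (weyl_mem_gaussianSpan a 0 hG')),
      fourier_add_of_integrable (integrable_of_mem_gaussianSpan hF')
        (integrable_of_mem_gaussianSpan hG'), Pi.add_apply, Pi.add_apply, hF, hG, mul_add]
  | smul r F _ hF =>
    rw [map_smul, Pi.smul_comp, Pi.smul_comp, fourier_const_smul, fourier_const_smul,
      Pi.smul_apply, Pi.smul_apply, hF, mul_smul_comm]

lemma integrable_mul_fourier (f : L2Space n) {F : (Fin n → ℂ) → ℂ} (hF : F ∈ gaussianSpan n) :
    Integrable fun x ↦ f x * 𝓕 (F ∘ complexify : ℝⁿ → ℂ) x :=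
  (Lp.memLp f).integrable_mul
    (memLp_fourier (integrable_of_mem_gaussianSpan hF) (memLp_of_mem_gaussianSpan hF))

lemma integrable_exp_mul_fourier (f : L2Space n) (a : ℝⁿ) {F : (Fin n → ℂ) → ℂ}
    (hF : F ∈ gaussianSpan n) :
    Integrable fun x ↦ ((Real.exp (inner ℝ a x) : ℂ) * f x) * 𝓕 (F ∘ complexify : ℝⁿ → ℂ) x := by
  refine (integrable_mul_fourier f (weyl_mem_gaussianSpan (complexify a) 0 hF)).congr
    (.of_forall fun x ↦ ?_)
  simp only [fourier_weyl_zero hF, complexify_dotProduct_complexify, ofReal_exp]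
  ring

lemma integral_fourier_mul_weyl_zero (f : L2Space n) (a : ℝⁿ) {F : (Fin n → ℂ) → ℂ}
    (hF : F ∈ gaussianSpan n) :
    ∫ ξ, (𝓕 f : L2Space n) ξ * weyl (complexify a) 0 F (complexify ξ) =
      ∫ x, ((Real.exp (inner ℝ a x) : ℂ) * f x) * 𝓕 (F ∘ complexify : ℝⁿ → ℂ) x := by
  have hw := weyl_mem_gaussianSpan (complexify a) 0 hF
  refine (integral_fourier_mul f (integrable_of_mem_gaussianSpan hw)
    (memLp_of_mem_gaussianSpan hw)).trans (integral_congr_ae (.of_forall fun x ↦ ?_))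
  simp only [fourier_weyl_zero hF, complexify_dotProduct_complexify, ofReal_exp]
  ring

lemma weylBound_zero_right (f : L2Space n) {a : ℝⁿ}
    (h : MemLp (fun x ↦ (Real.exp (inner ℝ a x) : ℂ) * f x) 2 volume) :
    WeylBound (𝓕 f : L2Space n) a 0
      (eLpNorm (fun x ↦ (Real.exp (inner ℝ a x) : ℂ) * f x) 2 volume).toReal := by
  intro F hF
  have h1 := integrable_of_mem_gaussianSpan hF
  have h2 := memLp_of_mem_gaussianSpan hF
  rw [map_zero, integral_fourier_mul_weyl_zero f a hF, ← eLpNorm_fourier h1 h2]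
  exact norm_integral_mul_le h (memLp_fourier h1 h2)

lemma weylBound_zero_left {v : ℝⁿ → ℂ} {c : ℝⁿ}
    (h : MemLp (fun ξ ↦ (Real.exp (2 * Real.pi * inner ℝ c ξ) : ℂ) * v ξ) 2 volume) :
    WeylBound v 0 c
      (eLpNorm (fun ξ ↦ (Real.exp (2 * Real.pi * inner ℝ c ξ) : ℂ) * v ξ) 2 volume).toReal := by
  intro F hF
  refine le_of_eq_of_le ?_ (norm_integral_mul_le h (memLp_of_mem_gaussianSpan hF))
  congr 1
  refine integral_congr_ae (.of_forall fun ξ ↦ ?_)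
  simp only [weyl_apply, map_zero, smul_zero, sub_zero, zero_dotProduct, mul_zero,
    complexify_dotProduct_complexify, Function.comp_apply]
  push_cast
  ring

lemma exists_lp_forall_eq_integral_mul (l : gaussianSpan n →ₗ[ℂ] ℂ) {M : ℝ} (hM : 0 ≤ M)
    (hl : ∀ F : gaussianSpan n,
      ‖l F‖ ≤ M * (eLpNorm ((F : (Fin n → ℂ) → ℂ) ∘ complexify : ℝⁿ → ℂ) 2).toReal) :
    ∃ g : L2Space n, ‖g‖ ≤ M ∧
      ∀ F : gaussianSpan n, l F = ∫ x, g x * (F : (Fin n → ℂ) → ℂ) (complexify x) := by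
  let e : gaussianSpan n →ₗ[ℂ] L2Space n :=
    { toFun := fun F ↦ (memLp_of_mem_gaussianSpan F.2).toLp _
      map_add' := fun _ _ ↦ rfl
      map_smul' := fun _ _ ↦ rfl }
  obtain ⟨h, hh, hlh⟩ := exists_norm_le_forall_eq_inner e l hM fun F ↦
    (hl F).trans_eq (congrArg (M * ·) (Lp.norm_toLp _ (memLp_of_mem_gaussianSpan F.2)).symm)
  refine ⟨(Lp.memLp h).star.toLp _, ?_, fun F ↦ ?_⟩
  · rwa [Lp.norm_toLp, eLpNorm_star, ← Lp.norm_def]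
  rw [hlh, L2.inner_def]
  refine integral_congr_ae ?_
  filter_upwards [(Lp.memLp h).star.coeFn_toLp, (memLp_of_mem_gaussianSpan F.2).coeFn_toLp]
    with x hx hF
  rw [hx, RCLike.inner_apply']
  exact congrArg _ hF

lemma ae_eq_zero_of_integral_mul_fourier_eq_zero {g : ℝⁿ → ℂ}
    (hg : ∀ F ∈ gaussianSpan n, Integrable fun x ↦ g x * 𝓕 (F ∘ complexify : ℝⁿ → ℂ) x)
    (h : ∀ F ∈ gaussianSpan n, ∫ x, g x * 𝓕 (F ∘ complexify : ℝⁿ → ℂ) x = 0) :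
    g =ᵐ[volume] 0 := by
  have hγ : gaussian 1 0 ∈ gaussianSpan n := gaussian_mem_gaussianSpan (by simp) 0
  have hzero := ae_eq_zero_of_fourier_eq_zero (hg _ hγ) fun ξ ↦ by
    rw [Real.fourier_eq', ← h _ (weyl_mem_gaussianSpan ((-2 * Real.pi * I) • complexify ξ) 0 hγ)]
    refine integral_congr_ae (.of_forall fun x ↦ ?_)
    simp only [fourier_weyl_zero hγ, smul_dotProduct, complexify_dotProduct_complexify,
      real_inner_comm, smul_eq_mul]
    push_cast
    ring_nf
  filter_upwards [hzero] with x hx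
  exact (mul_eq_zero.1 hx).resolve_right (fourier_gaussian_ne_zero (by simp) 0 x)

lemma WeylBound.exists_lp {v : ℝⁿ → ℂ} (hv : MemLp v 2 volume) {a c : ℝⁿ} {M : ℝ} (hM : 0 ≤ M)
    (h : WeylBound v a c M) :
    ∃ k : L2Space n, ‖k‖ ≤ M ∧ ∀ F ∈ gaussianSpan n,
      ∫ ξ, v ξ * weyl (complexify a) (complexify c) F (complexify ξ) =
        ∫ ξ, k ξ * F (complexify ξ) := by
  let l : gaussianSpan n →ₗ[ℂ] ℂ :=
    { toFun := fun F ↦ ∫ ξ, v ξ * weyl (complexify a) (complexify c) F (complexify ξ)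
      map_add' := fun F G ↦ by
        simp only [Submodule.coe_add, map_add, Pi.add_apply, mul_add]
        exact integral_add (integrable_mul_weyl hv F.2 _ _) (integrable_mul_weyl hv G.2 _ _)
      map_smul' := fun r F ↦ by
        simp only [Submodule.coe_smul, map_smul, Pi.smul_apply, mul_smul_comm, integral_smul,
          RingHom.id_apply] }
  obtain ⟨k, hk, hkl⟩ := exists_lp_forall_eq_integral_mul l hM fun F ↦ h F F.2
  exact ⟨k, hk, fun F hF ↦ hkl ⟨F, hF⟩⟩

theorem WeylBound.eLpNorm_le {f : L2Space n} {a : ℝⁿ} {M : ℝ} (hM : 0 ≤ M)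
    (h : WeylBound (𝓕 f : L2Space n) a 0 M) :
    eLpNorm (fun x ↦ (Real.exp (inner ℝ a x) : ℂ) * f x) 2 volume ≤ ENNReal.ofReal M := by
  obtain ⟨k, hk, hkF⟩ := h.exists_lp (Lp.memLp _) hM
  obtain ⟨g, rfl⟩ : ∃ g : L2Space n, (𝓕 g : L2Space n) = k :=
    (Lp.fourierTransformₗᵢ ℝⁿ ℂ).surjective k
  rw [Lp.norm_fourier_eq] at hk
  have hzero := ae_eq_zero_of_integral_mul_fourier_eq_zero
    (g := fun x ↦ (Real.exp (inner ℝ a x) : ℂ) * f x - g x)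
    (fun F hF ↦ by
      simp only [sub_mul]
      exact (integrable_exp_mul_fourier f a hF).sub (integrable_mul_fourier g hF))
    fun F hF ↦ by
      simp only [sub_mul]
      rw [integral_sub (integrable_exp_mul_fourier f a hF) (integrable_mul_fourier g hF),
        ← integral_fourier_mul_weyl_zero f a hF,
        ← integral_fourier_mul g (integrable_of_mem_gaussianSpan hF)
          (memLp_of_mem_gaussianSpan hF), sub_eq_zero]
      simpa only [map_zero, Function.comp_apply] using hkF F hF
  have hae : (fun x ↦ (Real.exp (inner ℝ a x) : ℂ) * f x) =ᵐ[volume] g := by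
    filter_upwards [hzero] with x hx using sub_eq_zero.1 hx
  rw [eLpNorm_congr_ae hae, ← ENNReal.ofReal_toReal (Lp.memLp g).2.ne, ← Lp.norm_def]
  exact ENNReal.ofReal_le_ofReal hk

end Weights

/-! ### Quadratic weights -/

section QuadraticWeights

section

variable {V : Type*} [NormedAddCommGroup V] [InnerProductSpace ℝ V]

lemma ofReal_exp_neg_mul_sq_norm_add (b c : ℝ) (w v : V) :
    ((Real.exp (-b * ‖v‖ ^ 2 + c * inner ℝ w v) : ℝ) : ℂ) =
      Complex.exp (-(b : ℂ) * (‖v‖ : ℂ) ^ 2 + (c : ℂ) * ((inner ℝ w v : ℝ) : ℂ)) := by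
  push_cast
  rfl

variable [FiniteDimensional ℝ V] [MeasurableSpace V] [BorelSpace V] {b : ℝ}

lemma integrable_exp_neg_mul_sq_norm_add (hb : 0 < b) (c : ℝ) (w : V) :
    Integrable fun v : V ↦ Real.exp (-b * ‖v‖ ^ 2 + c * inner ℝ w v) := by
  have h := GaussianFourier.integrable_cexp_neg_mul_sq_norm_add (b := (b : ℂ)) hb (c : ℂ) w
  simp only [← ofReal_exp_neg_mul_sq_norm_add] at h
  exact h.re

lemma integral_exp_neg_mul_sq_norm_add (hb : 0 < b) (c : ℝ) (w : V) :
    ∫ v : V, Real.exp (-b * ‖v‖ ^ 2 + c * inner ℝ w v) =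
      (Real.pi / b) ^ (Module.finrank ℝ V / 2 : ℝ) * Real.exp (c ^ 2 * ‖w‖ ^ 2 / (4 * b)) := by
  have h := GaussianFourier.integral_cexp_neg_mul_sq_norm_add (b := (b : ℂ)) hb (c : ℂ) w
  simp only [← ofReal_exp_neg_mul_sq_norm_add] at h
  rw [integral_complex_ofReal] at h
  apply Complex.ofReal_injective
  rw [h, Complex.ofReal_mul, Complex.ofReal_cpow (by positivity)]
  push_cast
  rfl

end

lemma lintegral_exp_mul_exp_inner (r : ℝ) (x : ℝⁿ) :
    ∫⁻ lam : ℝⁿ, ENNReal.ofReal (Real.exp (-(‖lam‖ ^ 2 / 2))) *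
        ENNReal.ofReal (Real.exp (2 * (inner ℝ lam x / r))) =
      ENNReal.ofReal ((2 * Real.pi) ^ (n / 2 : ℝ)) *
        ENNReal.ofReal (Real.exp (2 * (‖x‖ ^ 2 / r ^ 2))) := by
  have hexp (lam : ℝⁿ) : ENNReal.ofReal (Real.exp (-(‖lam‖ ^ 2 / 2))) *
      ENNReal.ofReal (Real.exp (2 * (inner ℝ lam x / r))) =
      ENNReal.ofReal (Real.exp (-(1 / 2) * ‖lam‖ ^ 2 + 2 / r * inner ℝ x lam)) := by
    rw [← ENNReal.ofReal_mul (by positivity), ← Real.exp_add, real_inner_comm]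
    ring_nf
  simp only [hexp]
  rw [← ofReal_integral_eq_lintegral_ofReal
      (integrable_exp_neg_mul_sq_norm_add (by norm_num) _ x) (.of_forall fun _ ↦ by positivity),
    integral_exp_neg_mul_sq_norm_add (by norm_num), ENNReal.ofReal_mul (by positivity),
    finrank_euclideanSpace_fin]
  ring_nf

lemma expWeightedNorm_sq (w : ℝⁿ → ℝ) (f : ℝⁿ → ℂ) :
    expWeightedNorm w f ^ (2 : ℝ) =
      ∫⁻ x, ENNReal.ofReal (Real.exp (2 * w x)) * ‖f x‖ₑ ^ (2 : ℝ) := by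
  rw [expWeightedNorm, eLpNorm_eq_lintegral_rpow_enorm_toReal (by norm_num) (by norm_num),
    ENNReal.toReal_ofNat, one_div, ENNReal.rpow_inv_rpow (by norm_num)]
  refine lintegral_congr fun x ↦ ?_
  rw [enorm_mul, ENNReal.mul_rpow_of_nonneg _ _ (by norm_num), ← ofReal_norm, Complex.norm_real,
    Real.norm_of_nonneg (Real.exp_nonneg _), ENNReal.ofReal_rpow_of_pos (Real.exp_pos _),
    ← Real.exp_mul, mul_comm (w x)]

lemma aemeasurable_exp_inner_mul_enorm (r : ℝ) {f : ℝⁿ → ℂ} (hf : AEStronglyMeasurable f volume) :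
    AEMeasurable (fun p : ℝⁿ × ℝⁿ ↦
      ENNReal.ofReal (Real.exp (2 * (inner ℝ p.1 p.2 / r))) * ‖f p.2‖ₑ ^ (2 : ℝ))
      (volume.prod volume) :=
  AEMeasurable.mul (by fun_prop) (hf.comp_snd.enorm.pow_const _)

lemma aemeasurable_expWeightedNorm_inner (r : ℝ) {f : ℝⁿ → ℂ}
    (hf : AEStronglyMeasurable f volume) :
    AEMeasurable fun lam : ℝⁿ ↦ expWeightedNorm (fun x ↦ inner ℝ lam x / r) f ^ (2 : ℝ) := by
  simp only [expWeightedNorm_sq]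
  exact (aemeasurable_exp_inner_mul_enorm r hf).lintegral_prod_right'

lemma lintegral_expWeightedNorm_inner (r : ℝ) {f : ℝⁿ → ℂ} (hf : AEStronglyMeasurable f volume) :
    ∫⁻ lam : ℝⁿ, ENNReal.ofReal (Real.exp (-(‖lam‖ ^ 2 / 2))) *
        expWeightedNorm (fun x ↦ inner ℝ lam x / r) f ^ (2 : ℝ) =
      ENNReal.ofReal ((2 * Real.pi) ^ (n / 2 : ℝ)) *
        expWeightedNorm (fun x ↦ ‖x‖ ^ 2 / r ^ 2) f ^ (2 : ℝ) := by
  simp only [expWeightedNorm_sq, ← lintegral_const_mul' _ _ ENNReal.ofReal_ne_top]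
  rw [lintegral_lintegral_swap]
  swap
  · exact AEMeasurable.mul (by fun_prop) (aemeasurable_exp_inner_mul_enorm r hf)
  refine lintegral_congr fun x ↦ ?_
  simp only [← mul_assoc]
  rw [lintegral_mul_const _ (by fun_prop), lintegral_exp_mul_exp_inner]

lemma mul_rpow_mul_rpow_sq {c : ℝ≥0∞} (hc₀ : c ≠ 0) (hc : c ≠ ⊤) (A B : ℝ≥0∞) {θ : ℝ}
    (hθ₀ : 0 ≤ θ) (hθ₁ : θ ≤ 1) :
    c * (A ^ θ * B ^ (1 - θ)) ^ (2 : ℝ) =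
      (c * A ^ (2 : ℝ)) ^ θ * (c * B ^ (2 : ℝ)) ^ (1 - θ) := by
  rw [ENNReal.mul_rpow_of_nonneg _ _ hθ₀, ENNReal.mul_rpow_of_nonneg _ _ (sub_nonneg.2 hθ₁),
    ENNReal.mul_rpow_of_nonneg _ _ zero_le_two, mul_mul_mul_comm,
    ← ENNReal.rpow_add _ _ hc₀ hc, add_sub_cancel, ENNReal.rpow_one]
  simp only [← ENNReal.rpow_mul]
  rw [mul_comm θ 2, mul_comm (1 - θ) 2]

theorem expWeightedNorm_sq_norm_le_of_inner {f g h : ℝⁿ → ℂ} (hf : AEStronglyMeasurable f volume)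
    (hg : AEStronglyMeasurable g volume) (hh : AEStronglyMeasurable h volume)
    {r₀ r₁ r₂ θ : ℝ} (hθ₀ : 0 ≤ θ) (hθ₁ : θ ≤ 1)
    (H : ∀ lam : ℝⁿ, expWeightedNorm (fun x ↦ inner ℝ lam x / r₀) f ≤
      expWeightedNorm (fun x ↦ inner ℝ lam x / r₁) g ^ θ *
        expWeightedNorm (fun x ↦ inner ℝ lam x / r₂) h ^ (1 - θ)) :
    expWeightedNorm (fun x ↦ ‖x‖ ^ 2 / r₀ ^ 2) f ≤
      expWeightedNorm (fun x ↦ ‖x‖ ^ 2 / r₁ ^ 2) g ^ θ *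
        expWeightedNorm (fun x ↦ ‖x‖ ^ 2 / r₂ ^ 2) h ^ (1 - θ) := by
  have hc₀ : ENNReal.ofReal ((2 * Real.pi) ^ (n / 2 : ℝ)) ≠ 0 :=
    (ENNReal.ofReal_pos.2 (by positivity)).ne'
  rw [← ENNReal.rpow_le_rpow_iff zero_lt_two,
    ← ENNReal.mul_le_mul_iff_right hc₀ ENNReal.ofReal_ne_top,
    mul_rpow_mul_rpow_sq hc₀ ENNReal.ofReal_ne_top _ _ hθ₀ hθ₁,
    ← lintegral_expWeightedNorm_inner r₀ hf, ← lintegral_expWeightedNorm_inner r₁ hg,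
    ← lintegral_expWeightedNorm_inner r₂ hh]
  refine (lintegral_mono fun lam ↦ ?_).trans (ENNReal.lintegral_mul_norm_pow_le
    (AEMeasurable.mul (by fun_prop) (aemeasurable_expWeightedNorm_inner r₁ hg))
    (AEMeasurable.mul (by fun_prop) (aemeasurable_expWeightedNorm_inner r₂ hh))
    hθ₀ (sub_nonneg.2 hθ₁) (add_sub_cancel _ _))
  simp only [Pi.mul_apply]
  rw [← mul_rpow_mul_rpow_sq (ENNReal.ofReal_pos.2 (Real.exp_pos _)).ne' ENNReal.ofReal_ne_top _ _
    hθ₀ hθ₁]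
  gcongr
  exact H lam

end QuadraticWeights

/-! ### Interpolation along the free evolution -/

section Evolution

variable {u₀ : L2Space n} {u : ℝ → L2Space n}

lemma le_rpow_mul_rpow_of_toReal {X A B : ℝ≥0∞} {θ : ℝ} (hθ₀ : 0 < θ) (hθ₁ : θ < 1)
    (hA : A = 0 → X = 0) (hB : B = 0 → X = 0)
    (h : A ≠ ⊤ → B ≠ ⊤ → X ≤ ENNReal.ofReal (A.toReal ^ θ * B.toReal ^ (1 - θ))) :
    X ≤ A ^ θ * B ^ (1 - θ) := by
  have hθ' : 0 < 1 - θ := sub_pos.2 hθ₁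
  rcases eq_or_ne A 0 with hA₀ | hA₀
  · simp only [hA hA₀, zero_le]
  rcases eq_or_ne B 0 with hB₀ | hB₀
  · simp only [hB hB₀, zero_le]
  rcases eq_or_ne A ⊤ with rfl | hAt
  · simp [ENNReal.top_rpow_of_pos hθ₀, ENNReal.top_mul, ENNReal.rpow_eq_zero_iff_of_pos hθ', hB₀]
  rcases eq_or_ne B ⊤ with rfl | hBt
  · simp [ENNReal.top_rpow_of_pos hθ', ENNReal.mul_top, ENNReal.rpow_eq_zero_iff_of_pos hθ₀, hA₀]
  refine (h hAt hBt).trans_eq ?_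
  rw [ENNReal.ofReal_mul (by positivity), ENNReal.toReal_rpow, ENNReal.toReal_rpow,
    ENNReal.ofReal_toReal (ENNReal.rpow_ne_top_of_nonneg hθ₀.le hAt),
    ENNReal.ofReal_toReal (ENNReal.rpow_ne_top_of_nonneg hθ'.le hBt)]

lemma aestronglyMeasurable_exp_mul {w : ℝⁿ → ℝ} (hw : Continuous w) (f : L2Space n) :
    AEStronglyMeasurable (fun x ↦ (Real.exp (w x) : ℂ) * f x) volume :=
  (by fun_prop : Continuous fun x ↦ (Real.exp (w x) : ℂ)).aestronglyMeasurable.mul (Lp.memLp f).1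

lemma eq_zero_of_expWeightedNorm_eq_zero {w : ℝⁿ → ℝ} (hw : Continuous w) {f : L2Space n}
    (h : expWeightedNorm w f = 0) : f = 0 := by
  rw [expWeightedNorm, eLpNorm_eq_zero_iff (aestronglyMeasurable_exp_mul hw f) two_ne_zero] at h
  rw [Lp.eq_zero_iff_ae_eq_zero]
  filter_upwards [h] with x hx
  exact (mul_eq_zero.1 hx).resolve_left (by exact_mod_cast (Real.exp_pos _).ne')

lemma expWeightedNorm_zero (w : ℝⁿ → ℝ) : expWeightedNorm w (0 : L2Space n) = 0 := by
  refine (eLpNorm_congr_ae ?_).trans (eLpNorm_zero (ε := ℂ))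
  filter_upwards [Lp.coeFn_zero ℂ 2 (volume : Measure ℝⁿ)] with x hx
  rw [hx, Pi.zero_apply, mul_zero]

lemma IsFreeSchrodingerSolution.norm_eq (hu : IsFreeSchrodingerSolution u₀ u) {t : ℝ}
    (ht : 0 ≤ t) : ‖u t‖ = ‖u₀‖ := by
  rw [← Lp.norm_fourier_eq, ← Lp.norm_fourier_eq u₀, Lp.norm_def, Lp.norm_def]
  congr 1
  refine eLpNorm_congr_norm_ae ?_
  filter_upwards [hu.fourier_ae_eq ht] with ξ hξ
  rw [hξ, norm_mul, norm_exp_mul_freeSymbol, one_mul]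

lemma IsFreeSchrodingerSolution.eq_zero_iff (hu : IsFreeSchrodingerSolution u₀ u) {t : ℝ}
    (ht : 0 ≤ t) : u t = 0 ↔ u₀ = 0 := by
  rw [← norm_eq_zero, hu.norm_eq ht, norm_eq_zero]

lemma IsFreeSchrodingerSolution.weylBound (hu : IsFreeSchrodingerSolution u₀ u) {t : ℝ}
    (ht : 0 ≤ t) {a : ℝⁿ} (h : expWeightedNorm (inner ℝ a) (u t) ≠ ⊤) :
    WeylBound (𝓕 u₀ : L2Space n) a ((2 * t) • a) (expWeightedNorm (inner ℝ a) (u t)).toReal := by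
  rw [← zero_add ((2 * t) • a), ← weylBound_free_iff (hu.fourier_ae_eq ht)]
  exact weylBound_zero_right (u t) ⟨aestronglyMeasurable_exp_mul (by fun_prop) _, h.lt_top⟩

lemma IsFreeSchrodingerSolution.expWeightedNorm_le (hu : IsFreeSchrodingerSolution u₀ u) {t : ℝ}
    (ht : 0 ≤ t) {a : ℝⁿ} {M : ℝ} (hM : 0 ≤ M)
    (h : WeylBound (𝓕 u₀ : L2Space n) a ((2 * t) • a) M) :
    expWeightedNorm (inner ℝ a) (u t) ≤ ENNReal.ofReal M := by
  rw [← zero_add ((2 * t) • a), ← weylBound_free_iff (hu.fourier_ae_eq ht)] at h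
  exact h.eLpNorm_le hM

theorem IsFreeSchrodingerSolution.expWeightedNorm_le_of_weylBound
    (hu : IsFreeSchrodingerSolution u₀ u) {t : ℝ} (ht : 0 ≤ t) {A B : ℝ≥0∞} {a₀ a₁ c₀ c₁ a : ℝⁿ}
    (hA₀ : A = 0 → u₀ = 0) (hB₀ : B = 0 → u₀ = 0)
    (hA : A ≠ ⊤ → WeylBound (𝓕 u₀ : L2Space n) a₁ c₁ A.toReal)
    (hB : B ≠ ⊤ → WeylBound (𝓕 u₀ : L2Space n) a₀ c₀ B.toReal)
    {θ : ℝ} (hθ₀ : 0 < θ) (hθ₁ : θ < 1) (ha : a₀ + θ • (a₁ - a₀) = a)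
    (hc : c₀ + θ • (c₁ - c₀) = (2 * t) • a) :
    expWeightedNorm (inner ℝ a) (u t) ≤ A ^ θ * B ^ (1 - θ) := by
  have eq_zero_of_initial (h : u₀ = 0) : expWeightedNorm (inner ℝ a) (u t) = 0 := by
    rw [(hu.eq_zero_iff ht).2 h, expWeightedNorm_zero]
  refine le_rpow_mul_rpow_of_toReal hθ₀ hθ₁ (eq_zero_of_initial ∘ hA₀) (eq_zero_of_initial ∘ hB₀)
    fun hAt hBt ↦ hu.expWeightedNorm_le ht (by positivity) ?_
  have h := WeylBound.interp (Lp.memLp _) ENNReal.toReal_nonneg ENNReal.toReal_nonneg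
    (hB hBt) (hA hAt) hθ₀.le hθ₁.le
  rwa [ha, hc, mul_comm (_ ^ _)] at h

lemma inner_div_eq (lam x : ℝⁿ) (r : ℝ) : inner ℝ lam x / r = inner ℝ (r⁻¹ • lam) x := by
  rw [real_inner_smul_left, div_eq_inv_mul]

lemma thetaExponent_zero {α β T : ℝ} (hβ : β ≠ 0) (hT : T ≠ 0) : thetaExponent α β T 0 = 1 := by
  rw [thetaExponent, sub_zero, mul_zero, zero_add, mul_comm, div_self (mul_ne_zero hT hβ)]

lemma thetaExponent_self (α β T : ℝ) : thetaExponent α β T T = 0 := by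
  rw [thetaExponent, sub_self, mul_zero, zero_div]

lemma thetaExponent_mem_Icc {α β T t : ℝ} (hα : 0 < α) (hβ : 0 < β) (hT : 0 < T)
    (ht : t ∈ Icc 0 T) :
    thetaExponent α β T t ∈ Icc 0 1 := by
  obtain ⟨ht₀, htT⟩ := ht
  refine ⟨div_nonneg (mul_nonneg hβ.le (sub_nonneg.2 htT)) (by positivity),
    (div_le_one (by positivity)).2 ?_⟩
  nlinarith [mul_nonneg hβ.le ht₀, mul_nonneg hT.le (mul_nonneg hα.le ht₀)]

lemma thetaExponent_mem_Ioo {α β T t : ℝ} (hα : 0 < α) (hβ : 0 < β) (ht : t ∈ Ioo 0 T) :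
    thetaExponent α β T t ∈ Ioo 0 1 := by
  obtain ⟨ht₀, htT⟩ := ht
  have hT : 0 < T := ht₀.trans htT
  refine ⟨div_pos (mul_pos hβ (sub_pos.2 htT)) (by positivity),
    (div_lt_one (by positivity)).2 ?_⟩
  nlinarith [mul_pos hβ ht₀, mul_pos hT (mul_pos hα ht₀)]

theorem IsFreeSchrodingerSolution.expWeightedNorm_inner_le_time
    (hu : IsFreeSchrodingerSolution u₀ u) {α β T t : ℝ} (hα : 0 < α) (hβ : 0 < β) (hT : 0 < T)
    (ht : 0 ≤ t) (htT : t ≤ T) (lam : ℝⁿ) :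
    expWeightedNorm (fun x ↦ inner ℝ lam x / (α * t + β)) (u t) ≤
      expWeightedNorm (fun x ↦ inner ℝ lam x / β) u₀ ^ thetaExponent α β T t *
        expWeightedNorm (fun x ↦ inner ℝ lam x / (α * T + β)) (u T) ^
          (1 - thetaExponent α β T t) := by
  rcases ht.eq_or_lt with rfl | ht₀
  · rw [thetaExponent_zero hβ.ne' hT.ne', sub_self, ENNReal.rpow_one, ENNReal.rpow_zero, mul_one,
      hu.initial, mul_zero, zero_add]
  rcases htT.eq_or_lt with rfl | htT₀
  · rw [thetaExponent_self, sub_zero, ENNReal.rpow_one, ENNReal.rpow_zero, one_mul]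
  obtain ⟨hθ₀, hθ₁⟩ := thetaExponent_mem_Ioo hα hβ ⟨ht₀, htT₀⟩
  have hd : α * t + β ≠ 0 := by positivity
  have hD : α * T + β ≠ 0 := by positivity
  simp only [inner_div_eq]
  rw [← hu.initial]
  refine hu.expWeightedNorm_le_of_weylBound ht
    (fun h ↦ (hu.eq_zero_iff le_rfl).1 (eq_zero_of_expWeightedNorm_eq_zero (by fun_prop) h))
    (fun h ↦ (hu.eq_zero_iff hT.le).1 (eq_zero_of_expWeightedNorm_eq_zero (by fun_prop) h))
    (hu.weylBound le_rfl) (hu.weylBound hT.le) hθ₀ hθ₁ ?_ ?_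
  · rw [thetaExponent]
    match_scalars
    field_simp
    ring
  · rw [thetaExponent]
    match_scalars
    field_simp
    ring

lemma aestronglyMeasurable_angularFourier (f : L2Space n) :
    AEStronglyMeasurable (angularFourier f) volume := by
  have hquasi : Measure.QuasiMeasurePreserving (fun ξ : ℝⁿ ↦ (2 * Real.pi)⁻¹ • ξ) :=
    ⟨by fun_prop, by
      rw [Measure.map_addHaar_smul _ (by positivity)]
      exact Measure.smul_absolutelyContinuous⟩
  exact aestronglyMeasurable_const.mul
    ((Lp.memLp (𝓕 f : L2Space n)).1.comp_quasiMeasurePreserving hquasi)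

lemma eLpNorm_comp_smul {r : ℝ} (hr : 0 < r) (g : ℝⁿ → ℂ) :
    eLpNorm (fun ξ ↦ g (r⁻¹ • ξ)) 2 volume =
      ENNReal.ofReal (r ^ (n / 2 : ℝ)) * eLpNorm g 2 volume := by
  have hr' : r⁻¹ ≠ 0 := inv_ne_zero hr.ne'
  have hmap := (Homeomorph.smulOfNeZero r⁻¹ hr').measurableEmbedding.eLpNorm_map_measure
    (g := g) (p := 2) (μ := (volume : Measure ℝⁿ))
  refine hmap.symm.trans ?_
  change eLpNorm g 2 (Measure.map (r⁻¹ • ·) volume) = _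
  rw [Measure.map_addHaar_smul _ hr', eLpNorm_smul_measure_of_ne_top (by norm_num),
    finrank_euclideanSpace_fin, inv_pow, inv_inv, abs_of_pos (by positivity),
    ENNReal.ofReal_rpow_of_pos (by positivity), ← Real.rpow_natCast, ← Real.rpow_mul hr.le,
    smul_eq_mul, ENNReal.toReal_div, ENNReal.toReal_one, ENNReal.toReal_ofNat, mul_one_div]

lemma expWeightedNorm_angularFourier (w : ℝⁿ → ℝ) (f : L2Space n) :
    expWeightedNorm w (angularFourier f) =
      expWeightedNorm (fun ξ ↦ w ((2 * Real.pi) • ξ)) (𝓕 f : L2Space n) := by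
  let g (ξ : ℝⁿ) : ℂ := (Real.exp (w ((2 * Real.pi) • ξ)) : ℂ) * (𝓕 f : L2Space n) ξ
  have hscale : (fun ξ ↦ (Real.exp (w ξ) : ℂ) * angularFourier f ξ) =
      (((2 * Real.pi) ^ (-n / 2 : ℝ) : ℝ) : ℂ) • fun ξ ↦ g ((2 * Real.pi)⁻¹ • ξ) := by
    funext ξ
    simp only [g, angularFourier, Pi.smul_apply, smul_inv_smul₀ Real.two_pi_pos.ne', smul_eq_mul]
    ring
  rw [expWeightedNorm, hscale, eLpNorm_const_smul, eLpNorm_comp_smul Real.two_pi_pos g, ← mul_assoc,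
    ← ofReal_norm, Complex.norm_real, Real.norm_of_nonneg (by positivity),
    ← ENNReal.ofReal_mul (by positivity), ← Real.rpow_add Real.two_pi_pos, neg_div, neg_add_cancel,
    Real.rpow_zero, ENNReal.ofReal_one, one_mul, expWeightedNorm]

lemma muExponent_zero {α β : ℝ} (hβ : β ≠ 0) : muExponent α β 0 = 1 := by
  rw [muExponent, mul_zero, zero_add, div_self hβ]

lemma muExponent_mem_Icc {α β t : ℝ} (hα : 0 < α) (hβ : 0 < β) (ht : 0 ≤ t) :
    muExponent α β t ∈ Icc 0 1 :=
  ⟨by unfold muExponent; positivity,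
    (div_le_one (by positivity)).2 (le_add_of_nonneg_left (by positivity))⟩

lemma muExponent_mem_Ioo {α β t : ℝ} (hα : 0 < α) (hβ : 0 < β) (ht : 0 < t) :
    muExponent α β t ∈ Ioo 0 1 :=
  ⟨by unfold muExponent; positivity,
    (div_lt_one (by positivity)).2 (lt_add_of_pos_left _ (by positivity))⟩

theorem IsFreeSchrodingerSolution.expWeightedNorm_inner_le_fourier
    (hu : IsFreeSchrodingerSolution u₀ u) {α β t : ℝ} (hα : 0 < α) (hβ : 0 < β) (ht : 0 ≤ t)
    (lam : ℝⁿ) :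
    expWeightedNorm (fun x ↦ inner ℝ lam x / (α * t + β)) (u t) ≤
      expWeightedNorm (fun x ↦ inner ℝ lam x / β) u₀ ^ muExponent α β t *
        expWeightedNorm (fun ξ ↦ inner ℝ lam ξ / (α / 2)) (angularFourier u₀) ^
          (1 - muExponent α β t) := by
  rcases ht.eq_or_lt with rfl | ht₀
  · rw [muExponent_zero hβ.ne', sub_self, ENNReal.rpow_one, ENNReal.rpow_zero, mul_one,
      hu.initial, mul_zero, zero_add]
  obtain ⟨hμ₀, hμ₁⟩ := muExponent_mem_Ioo hα hβ ht₀
  have hd : α * t + β ≠ 0 := by positivity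
  simp only [inner_div_eq, expWeightedNorm_angularFourier, inner_smul_right]
  have hA₀ := hu.weylBound le_rfl (a := β⁻¹ • lam)
  rw [hu.initial, mul_zero, zero_smul] at hA₀
  refine hu.expWeightedNorm_le_of_weylBound ht (eq_zero_of_expWeightedNorm_eq_zero (by fun_prop))
    (fun h ↦ ?_) hA₀ (fun h ↦ weylBound_zero_left
      ⟨aestronglyMeasurable_exp_mul (by fun_prop) _, h.lt_top⟩) hμ₀ hμ₁ ?_ ?_
  · have hF : (𝓕 u₀ : L2Space n) = 0 := eq_zero_of_expWeightedNorm_eq_zero (by fun_prop) h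
    rw [← norm_eq_zero, ← Lp.norm_fourier_eq, hF, norm_zero]
  · rw [muExponent]
    match_scalars
    field_simp
  · rw [muExponent]
    match_scalars
    field_simp
    ring

end Evolution

end

/-- The norms take values in `[0, ∞]`, so each inequality says in particular that its left-hand
side is finite whenever its right-hand side is. -/
theorem theorem1p2 (n : ℕ) (α β : ℝ) (hα : 0 < α) (hβ : 0 < β)
    (u₀ : L2Space n) (u : ℝ → L2Space n) (hu : IsFreeSchrodingerSolution u₀ u) :
    (∀ (lam : EuclideanSpace ℝ (Fin n)) (T : ℝ), 0 < T → ∀ t : ℝ, 0 ≤ t → t ≤ T →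
      expWeightedNorm (fun x => inner ℝ lam x / (α * t + β)) (u t) ≤
        expWeightedNorm (fun x => inner ℝ lam x / β) u₀ ^ thetaExponent α β T t *
          expWeightedNorm (fun x => inner ℝ lam x / (α * T + β)) (u T) ^
            (1 - thetaExponent α β T t)) ∧
    (∀ (lam : EuclideanSpace ℝ (Fin n)) (t : ℝ), 0 ≤ t →
      expWeightedNorm (fun x => inner ℝ lam x / (α * t + β)) (u t) ≤
        expWeightedNorm (fun x => inner ℝ lam x / β) u₀ ^ muExponent α β t *
          expWeightedNorm (fun ξ => 2 * inner ℝ lam ξ / α) (angularFourier u₀) ^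
            (1 - muExponent α β t)) ∧
    (∀ T : ℝ, 0 < T → ∀ t : ℝ, 0 ≤ t → t ≤ T →
      expWeightedNorm (fun x => ‖x‖ ^ 2 / (α * t + β) ^ 2) (u t) ≤
        expWeightedNorm (fun x => ‖x‖ ^ 2 / β ^ 2) u₀ ^ thetaExponent α β T t *
          expWeightedNorm (fun x => ‖x‖ ^ 2 / (α * T + β) ^ 2) (u T) ^
            (1 - thetaExponent α β T t)) ∧
    (∀ t : ℝ, 0 ≤ t →
      expWeightedNorm (fun x => ‖x‖ ^ 2 / (α * t + β) ^ 2) (u t) ≤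
        expWeightedNorm (fun x => ‖x‖ ^ 2 / β ^ 2) u₀ ^ muExponent α β t *
          expWeightedNorm (fun ξ => 4 * ‖ξ‖ ^ 2 / α ^ 2) (angularFourier u₀) ^
            (1 - muExponent α β t)) := by
  have h2 (a : ℝ) : 2 * a / α = a / (α / 2) := by ring
  have h4 (a : ℝ) : 4 * a ^ 2 / α ^ 2 = a ^ 2 / (α / 2) ^ 2 := by ring
  simp only [h2, h4]
  refine ⟨fun lam T hT t ht htT ↦ hu.expWeightedNorm_inner_le_time hα hβ hT ht htT lam,
    fun lam t ht ↦ hu.expWeightedNorm_inner_le_fourier hα hβ ht lam, fun T hT t ht htT ↦ ?_,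
    fun t ht ↦ ?_⟩
  · obtain ⟨hθ₀, hθ₁⟩ := thetaExponent_mem_Icc hα hβ hT ⟨ht, htT⟩
    exact expWeightedNorm_sq_norm_le_of_inner (Lp.memLp _).1 (Lp.memLp _).1 (Lp.memLp _).1 hθ₀ hθ₁
      (hu.expWeightedNorm_inner_le_time hα hβ hT ht htT)
  · obtain ⟨hμ₀, hμ₁⟩ := muExponent_mem_Icc hα hβ ht
    exact expWeightedNorm_sq_norm_le_of_inner (Lp.memLp _).1 (Lp.memLp _).1
      (aestronglyMeasurable_angularFourier u₀) hμ₀ hμ₁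
      (hu.expWeightedNorm_inner_le_fourier hα hβ ht)
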